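/- Let $\lambda$ be an infinite regular cardinal. An $S$-sorted $\lambda$-ary signature $\Sigma$ has a set of function symbols $f\colon \sqcap_{i<\alpha}s_i\to s$ and a set of relation symbols $R\colon\sqcap_{i<\alpha}s_i$ with $\alpha<\lambda$ and $s_i,s\in S$. Horn formulas $\vec x.\phi$ in a context $\vec x=(x_i:s_i)_{i<\alpha}$ ($\alpha<\lambda$) are built from relations and equations between terms by conjunctions of length $<\lambda$ ($\top$ being the empty conjunction); $\tau{\downarrow}$ means $\tau=\tau$. A $\lambda$-ary partial Horn theory $(S,\Sigma,\mathbb T)$ is a set $\mathbb T$ of Horn sequents $\phi\vdash_{\vec x}\psi$ over $\Sigma$. A partial $\Sigma$-structure interprets sorts by sets, function symbols by partial maps and relation symbols by subsets; a compound term is defined only if all of its subterms are, and an atomic formula holds only if all terms in it are defined. $\mathbf{PMod}\,\mathbb T$ is the category of partial structures in which all sequents of $\mathbb T$ are valid, with the sortwise maps that preserve definedness and values of function symbols and preserve relations. A theory morphism $\rho\colon(S,\Sigma,\mathbb S)\to(S',\Sigma',\mathbb T)$ assigns to each sort $s\in S$ a sort $s^\rho\in S'$, to each function symbol $f\colon\sqcap_{i<\alpha}s_i\to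 s$ of $\Sigma$ a term $f^\rho$ of type $s^\rho$ over $\Sigma'$ in a context $\vec x^\rho=(x_i^\rho:s_i^\rho)_{i<\alpha}$, and to each relation symbol $R\colon\sqcap_{i<\alpha}s_i$ of $\Sigma$ a Horn formula $R^\rho$ over $\Sigma'$ in such a context, so that for every $\phi\vdash_{\vec x}\psi$ in $\mathbb S$ the translation $\phi^\rho\vdash_{\vec x^\rho}\psi^\rho$ is derivable from $\mathbb T$ in $\lambda$-ary partial Horn logic. Here terms and formulas are translated by replacing each symbol by its assigned term or formula, and the translation of an atomic formula also contains, as conjuncts, $\sigma^\rho{\downarrow}$ for every subterm $\sigma$ occurring in it. The translation functor $U^\rho\colon\mathbf{PMod}\,\mathbb T\to\mathbf{PMod}\,\mathbb S$ sends $M$ to the model with carriers $M_{s^\rho}$ in which $f$ and $R$ are interpreted by $f^\rho$ and $R^\rho$. A $\rho$-relative $\lambda$-ary judgment is a sequent $\phi^\rho\vdash_{\vec x^\rho}\psi$ with $\vec x.\phi$ a Horn formula over $\Sigma$ and $\vec x^\rho.\psi$ a Horn formula over $\Sigma'$. A monomorphism $m\colon A\to B$ in $\mathbf{PMod}\,\mathbb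 T$ is $\mathbb T$-closed if for every function symbol $f$ and every tuple $\vec a$ of $A$, $f^A(\vec a)$ is defined whenever $f^B(m\vec a)$ is, and for every relation symbol $R$, $\vec a\in R^A$ whenever $m\vec a\in R^B$. A morphism is $\mathbb T$-dense if it factors through no proper $\mathbb T$-closed subobject of its codomain. $N$ is a $U^\rho$-retract of $M$ if there is a morphism $p\colon M\to N$ such that $U^\rho p$ has a section. **Theorem.** Let $\rho\colon\mathbb S\to\mathbb T$ be a theory morphism between $\lambda$-ary partial Horn theories. Then $U^\rho$ has a left adjoint $F^\rho$, and for every replete full subcategory $\mathscr E\subseteq\mathbf{PMod}\,\mathbb T$ the following are equivalent: 1. $\mathscr E$ is definable by $\rho$-relative $\lambda$-ary judgments, i.e. there is a set $\mathbb T'$ of $\rho$-relative $\lambda$-ary judgments with $\mathscr E=\mathbf{PMod}(\mathbb T\cup\mathbb T')$. 2. There is a small family $\Lambda=\{e_i\colon F^\rho(\Gamma_i)\to\Delta_i\}_{i\in I}$ of $\mathbb T$-dense morphisms, with every $\Gamma_i$ $\lambda$-presentable in $\mathbf{PMod}\,\mathbb S$, such that $\mathscr E$ consists of exactly the $M\in\mathbf{PMod}\,\mathbb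 T$ orthogonal to all $e_i$ (each $g\colon F^\rho(\Gamma_i)\to M$ factors uniquely through $e_i$). 3. $\mathscr E\subseteq\mathbf{PMod}\,\mathbb T$ is closed under small products, $\mathbb T$-closed subobjects, $U^\rho$-retracts and small $\lambda$-filtered colimits. -/

import Mathlib

universe u

namespace PHL

open CategoryTheory Limits

/-! ## Infinitary partial Horn logic: signatures, terms, formulas -/

section Syntactic

/-- A tuple of sorts `(s_i)_{i < α}` with `α < κ`. An ordinal `α < κ` is represented by an element
`len` of the well-ordered type `κ.ord.ToType`, and `{i | i < α}` by `Set.Iio len`.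
Such a tuple serves as an arity and also as a context `(x_i : s_i)_{i < α}`; the variables
of a context are referred to by their positions, so they are automatically distinct. -/
structure Ctx (κ : Cardinal.{u}) (S : Type u) : Type u where
  len : κ.ord.ToType
  sort : Set.Iio len → S

/-- The index set `{i | i < α}` of a tuple. -/
abbrev Ctx.Pos {κ : Cardinal.{u}} {S : Type u} (x : Ctx κ S) : Type u := Set.Iio x.len

/-- Apply a map of sorts to every entry of a tuple of sorts. -/
abbrev Ctx.map {κ : Cardinal.{u}} {S S' : Type u} (g : S → S') (x : Ctx κ S) : Ctx κ S' where
  len := x.len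
  sort i := g (x.sort i)

/-- An `S`-sorted `κ`-ary signature. -/
structure Signature (κ : Cardinal.{u}) (S : Type u) : Type (u + 1) where
  Fun : Type u
  funArity : Fun → Ctx κ S
  funSort : Fun → S
  Rel : Type u
  relArity : Rel → Ctx κ S

variable {κ : Cardinal.{u}} {S : Type u}

/-- Terms of a given type in the context `x`. -/
inductive Term (Sg : Signature κ S) (x : Ctx κ S) : S → Type u
  | var (i : x.Pos) : Term Sg x (x.sort i)
  | app (f : Sg.Fun)
      (t : ∀ j : (Sg.funArity f).Pos, Term Sg x ((Sg.funArity f).sort j)) :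
      Term Sg x (Sg.funSort f)

/-- `κ`-ary Horn formulas in the context `x`. Conjunctions are indexed by ordinals `α < κ`;
truth is the empty conjunction (see `Formula.truth`). -/
inductive Formula (Sg : Signature κ S) (x : Ctx κ S) : Type u
  | rel (R : Sg.Rel)
      (t : ∀ j : (Sg.relArity R).Pos, Term Sg x ((Sg.relArity R).sort j)) : Formula Sg x
  | eq {s : S} (t t' : Term Sg x s) : Formula Sg x
  | conj (α : κ.ord.ToType) (φ : Set.Iio α → Formula Sg x) : Formula Sg x

/-- The element of `κ.ord.ToType` that represents the natural number `n`. -/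
noncomputable def natIdx (κ : Cardinal.{u}) [hκ : Fact κ.IsRegular] (n : ℕ) : κ.ord.ToType :=
  Ordinal.ToType.mk ⟨(n : Ordinal.{u}),
    lt_of_lt_of_le (Ordinal.natCast_lt_omega0 n)
      (by simpa using Cardinal.ord_le_ord.mpr hκ.out.aleph0_le)⟩

lemma not_lt_natIdx_zero [Fact κ.IsRegular] (i : κ.ord.ToType) : ¬ i < natIdx κ 0 := by
  obtain ⟨⟨a, ha⟩, rfl⟩ := Ordinal.ToType.mk.surjective i
  simp [natIdx]

variable {Sg : Signature κ S}

/-- `τ↓`, that is, `τ = τ`. -/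
def Term.defined {x : Ctx κ S} {s : S} (t : Term Sg x s) : Formula Sg x := Formula.eq t t

/-- `⊤`, the conjunction of length `0`. -/
noncomputable def Formula.truth [Fact κ.IsRegular] {x : Ctx κ S} : Formula Sg x :=
  Formula.conj (natIdx κ 0)
    (fun i => absurd (show (i : κ.ord.ToType) < natIdx κ 0 from i.2) (not_lt_natIdx_zero _))

open Classical in
/-- `φ ∧ ψ`, the conjunction `⋀_{i < 2} φ_i` with `φ_0 = φ` and `φ_1 = ψ`. -/
noncomputable def Formula.and [Fact κ.IsRegular] {x : Ctx κ S} (φ ψ : Formula Sg x) :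
    Formula Sg x :=
  Formula.conj (natIdx κ 2) (fun i => if (i : κ.ord.ToType) = natIdx κ 0 then φ else ψ)

/-- Simultaneous substitution `τ(σ/x)` in terms. -/
def Term.subst {x y : Ctx κ S} (σ : ∀ i : x.Pos, Term Sg y (x.sort i)) :
    {s : S} → Term Sg x s → Term Sg y s
  | _, .var i => σ i
  | _, .app f t => .app f (fun j => (t j).subst σ)

/-- Simultaneous substitution `φ(σ/x)` in formulas. -/
def Formula.subst {x y : Ctx κ S} (σ : ∀ i : x.Pos, Term Sg y (x.sort i)) :
    Formula Sg x → Formula Sg y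
  | .rel R t => .rel R (fun j => (t j).subst σ)
  | .eq t t' => .eq (t.subst σ) (t'.subst σ)
  | .conj α φ => .conj α (fun i => (φ i).subst σ)

/-- A Horn sequent `φ ⊢_x ψ`. -/
structure Sequent (Sg : Signature κ S) : Type u where
  ctx : Ctx κ S
  hyp : Formula Sg ctx
  concl : Formula Sg ctx

/-- A `κ`-ary partial Horn theory over `Sg`. -/
abbrev Theory (Sg : Signature κ S) : Type u := Set (Sequent Sg)

end Syntactic

/-! ## Derivations -/

section Derivation

variable {κ : Cardinal.{u}} [Fact κ.IsRegular] {S : Type u} {Sg : Signature κ S}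

/-- A tuple `(y_i : s_i)_{i < α}` of distinct variables of the context `z`,
of the same type as the context `x = (x_i : s_i)_{i < α}`. -/
structure Renaming (x z : Ctx κ S) : Type u where
  pos : x.Pos → z.Pos
  sort_eq : ∀ i, z.sort (pos i) = x.sort i
  inj : Function.Injective pos

/-- The variables of a renaming, seen as terms. -/
def Renaming.term {x z : Ctx κ S} (r : Renaming x z) (i : x.Pos) : Term Sg z (x.sort i) :=
  r.sort_eq i ▸ Term.var (r.pos i)

/-- `Derivable T (φ ⊢_x ψ)`: the sequent is a theorem of `T` in `κ`-ary partial Horn logic. -/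
inductive Derivable (T : Theory Sg) : Sequent Sg → Prop
  | ax (q : Sequent Sg) (hq : q ∈ T) : Derivable T q
  | id (x : Ctx κ S) (φ : Formula Sg x) : Derivable T ⟨x, φ, φ⟩
  | cut (x : Ctx κ S) (φ ψ χ : Formula Sg x) (h₁ : Derivable T ⟨x, φ, ψ⟩)
      (h₂ : Derivable T ⟨x, ψ, χ⟩) : Derivable T ⟨x, φ, χ⟩
  | subst (x y : Ctx κ S) (φ ψ : Formula Sg x) (τ : ∀ i : x.Pos, Term Sg y (x.sort i))
      (h : Derivable T ⟨x, φ, ψ⟩) :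
      Derivable T ⟨y, (φ.subst τ).and (.conj x.len (fun i => (τ i).defined)), ψ.subst τ⟩
  | refl (x : Ctx κ S) (i : x.Pos) :
      Derivable T ⟨x, Formula.truth, (Term.var i : Term Sg x (x.sort i)).defined⟩
  | eq (x z : Ctx κ S) (a b : Renaming x z) (φ : Formula Sg x) :
      Derivable T ⟨z, (φ.subst a.term).and (.conj x.len (fun i => .eq (a.term i) (b.term i))),
        φ.subst b.term⟩
  | strictRel (x : Ctx κ S) (R : Sg.Rel)
      (t : ∀ j : (Sg.relArity R).Pos, Term Sg x ((Sg.relArity R).sort j))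
      (j : (Sg.relArity R).Pos) : Derivable T ⟨x, .rel R t, (t j).defined⟩
  | strictEqLeft (x : Ctx κ S) {s : S} (t t' : Term Sg x s) :
      Derivable T ⟨x, .eq t t', t.defined⟩
  | strictEqRight (x : Ctx κ S) {s : S} (t t' : Term Sg x s) :
      Derivable T ⟨x, .eq t t', t'.defined⟩
  | strictFun (x : Ctx κ S) (f : Sg.Fun)
      (t : ∀ j : (Sg.funArity f).Pos, Term Sg x ((Sg.funArity f).sort j))
      (j : (Sg.funArity f).Pos) : Derivable T ⟨x, (Term.app f t).defined, (t j).defined⟩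
  | conjElim (x : Ctx κ S) (α : κ.ord.ToType) (φ : Set.Iio α → Formula Sg x) (j : Set.Iio α) :
      Derivable T ⟨x, .conj α φ, φ j⟩
  | conjIntro (x : Ctx κ S) (α : κ.ord.ToType) (φ : Formula Sg x)
      (ψ : Set.Iio α → Formula Sg x) (h : ∀ i, Derivable T ⟨x, φ, ψ i⟩) :
      Derivable T ⟨x, φ, .conj α ψ⟩

end Derivation

/-! ## Partial structures and partial models -/

section Semantics

variable {κ : Cardinal.{u}} {S : Type u}

/-- Partial structures over a signature. -/
structure PStr (Sg : Signature κ S) : Type (u + 1) where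
  carrier : S → Type u
  func (f : Sg.Fun) :
    (∀ j : (Sg.funArity f).Pos, carrier ((Sg.funArity f).sort j)) →. carrier (Sg.funSort f)
  rel (R : Sg.Rel) : Set (∀ j : (Sg.relArity R).Pos, carrier ((Sg.relArity R).sort j))

variable {Sg : Signature κ S}

/-- The interpretation of a term in context, as a partial function. -/
def Term.eval (M : PStr Sg) {x : Ctx κ S} (m : ∀ i : x.Pos, M.carrier (x.sort i)) :
    {s : S} → Term Sg x s → Part (M.carrier s)
  | _, .var i => Part.some (m i)
  | _, .app f t =>
      (Part.mk (∀ j, ((t j).eval M m).Dom) (fun h j => ((t j).eval M m).get (h j))).bind (M.func f)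

/-- `φ.Holds M m` means that `m` belongs to the interpretation of `φ` in `M`. -/
def Formula.Holds (M : PStr Sg) {x : Ctx κ S} (m : ∀ i : x.Pos, M.carrier (x.sort i)) :
    Formula Sg x → Prop
  | .rel R t => ∃ a ∈ M.rel R, ∀ j, a j ∈ (t j).eval M m
  | .eq t t' => ∃ a, a ∈ t.eval M m ∧ a ∈ t'.eval M m
  | .conj _ φ => ∀ i, (φ i).Holds M m

/-- Validity of a sequent in a partial structure. -/
def Sequent.Valid (q : Sequent Sg) (M : PStr Sg) : Prop :=
  ∀ m : (∀ i : q.ctx.Pos, M.carrier (q.ctx.sort i)), q.hyp.Holds M m → q.concl.Holds M m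

/-- Homomorphisms of partial structures. -/
@[ext]
structure PStr.Hom (M N : PStr Sg) : Type u where
  map : ∀ s : S, M.carrier s → N.carrier s
  map_func : ∀ (f : Sg.Fun) (a) (b), b ∈ M.func f a → map _ b ∈ N.func f (fun j => map _ (a j))
  map_rel : ∀ (R : Sg.Rel) (a), a ∈ M.rel R → (fun j => map _ (a j)) ∈ N.rel R

/-- The category of partial structures. -/
instance : Category.{u} (PStr Sg) where
  Hom := PStr.Hom
  id M := ⟨fun _ a => a, fun _ _ _ h => h, fun _ _ h => h⟩
  comp g h := ⟨fun s a => h.map s (g.map s a),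
    fun f _ _ hb => h.map_func f _ _ (g.map_func f _ _ hb),
    fun R _ ha => h.map_rel R _ (g.map_rel R _ ha)⟩

/-- `M` is a partial model of `T`. -/
def Theory.IsModel (T : Theory Sg) : ObjectProperty (PStr Sg) := fun M => ∀ q ∈ T, q.Valid M

/-- The category of partial models of `T`, a full subcategory of the partial structures. -/
abbrev PMod (T : Theory Sg) : Type (u + 1) := (Theory.IsModel T).FullSubcategory

/-- A monomorphism `m : A ⟶ B` of models is closed if the squares comparing the domains of function
symbols, and the interpretations of relation symbols, with the products of carriers are
pullbacks. -/
structure IsClosedMono {T : Theory Sg} {A B : PMod T} (m : A ⟶ B) : Prop where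
  mono : Mono m
  dom_of_dom : ∀ (f : Sg.Fun) (a : ∀ j, A.obj.carrier ((Sg.funArity f).sort j)),
    (B.obj.func f (fun j => m.hom.map _ (a j))).Dom → (A.obj.func f a).Dom
  rel_of_rel : ∀ (R : Sg.Rel) (a : ∀ j, A.obj.carrier ((Sg.relArity R).sort j)),
    (fun j => m.hom.map _ (a j)) ∈ B.obj.rel R → a ∈ A.obj.rel R

/-- A morphism `h : A ⟶ B` of models is dense if it factors through no proper closed subobject
of `B`. -/
def IsDense {T : Theory Sg} {A B : PMod T} (h : A ⟶ B) : Prop :=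
  ∀ ⦃C : PMod T⦄ (m : C ⟶ B), IsClosedMono m → (∃ g : A ⟶ C, g ≫ m = h) → IsIso m

/-! ### Soundness -/

lemma Term.mem_eval_app (M : PStr Sg) {x : Ctx κ S} (m : ∀ i : x.Pos, M.carrier (x.sort i))
    (f : Sg.Fun) (t : ∀ j : (Sg.funArity f).Pos, Term Sg x ((Sg.funArity f).sort j))
    (b : M.carrier (Sg.funSort f)) :
    b ∈ (Term.app f t).eval M m ↔ ∃ a, (∀ j, a j ∈ (t j).eval M m) ∧ b ∈ M.func f a := by
  rw [Term.eval]
  refine Part.mem_bind_iff.trans ⟨?_, ?_⟩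
  · rintro ⟨_, ⟨ha, rfl⟩, hb⟩
    exact ⟨_, fun j => Part.get_mem (ha j), hb⟩
  · rintro ⟨a, ha, hb⟩
    exact ⟨a, ⟨fun j => (ha j).1, funext fun j => (ha j).2⟩, hb⟩

lemma Term.map_eval {M N : PStr Sg} (h : M ⟶ N) {x : Ctx κ S}
    (m : ∀ i : x.Pos, M.carrier (x.sort i)) {s : S} (t : Term Sg x s) (a : M.carrier s)
    (ha : a ∈ t.eval M m) :
    PStr.Hom.map h s a ∈ t.eval N (fun i => PStr.Hom.map h _ (m i)) := by
  induction t with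
  | var i =>
    simp only [Term.eval, Part.mem_some_iff] at ha ⊢
    rw [ha]
  | app f t ih =>
    rw [Term.mem_eval_app] at ha ⊢
    obtain ⟨b, hb, hab⟩ := ha
    exact ⟨_, fun j => ih j _ (hb j), PStr.Hom.map_func h f _ _ hab⟩

lemma Formula.map_holds {M N : PStr Sg} (h : M ⟶ N) {x : Ctx κ S}
    (m : ∀ i : x.Pos, M.carrier (x.sort i)) (φ : Formula Sg x) (hφ : φ.Holds M m) :
    φ.Holds N (fun i => PStr.Hom.map h _ (m i)) := by
  induction φ with
  | rel R t =>
    obtain ⟨a, ha, hat⟩ := hφ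
    exact ⟨_, PStr.Hom.map_rel h R a ha, fun j => Term.map_eval h m (t j) _ (hat j)⟩
  | eq t t' =>
    obtain ⟨a, ha, ha'⟩ := hφ
    exact ⟨_, Term.map_eval h m t _ ha, Term.map_eval h m t' _ ha'⟩
  | conj α φ ih => exact fun i => ih i (hφ i)

lemma Term.defined_holds (M : PStr Sg) {x : Ctx κ S} (m : ∀ i : x.Pos, M.carrier (x.sort i))
    {s : S} (t : Term Sg x s) : t.defined.Holds M m ↔ ∃ a, a ∈ t.eval M m := by
  simp [Term.defined, Formula.Holds]

lemma Formula.and_holds [Fact κ.IsRegular] (M : PStr Sg) {x : Ctx κ S}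
    (m : ∀ i : x.Pos, M.carrier (x.sort i)) (φ ψ : Formula Sg x) :
    (φ.and ψ).Holds M m ↔ φ.Holds M m ∧ ψ.Holds M m := by
  have h0 : natIdx κ 0 < natIdx κ 2 := by simp [natIdx]
  have h1 : natIdx κ 1 < natIdx κ 2 := by simp [natIdx]
  have h10 : natIdx κ 1 ≠ natIdx κ 0 := by simp [natIdx]
  constructor
  · intro h
    constructor
    · simpa using h ⟨_, h0⟩
    · simpa [h10] using h ⟨_, h1⟩
  · rintro ⟨h₁, h₂⟩ i
    by_cases hi : (i : κ.ord.ToType) = natIdx κ 0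
    · simpa [hi] using h₁
    · simpa [hi] using h₂

lemma Term.mem_eval_subst (M : PStr Sg) {x y : Ctx κ S}
    (m : ∀ i : y.Pos, M.carrier (y.sort i)) (σ : ∀ i : x.Pos, Term Sg y (x.sort i))
    (a : ∀ i : x.Pos, M.carrier (x.sort i)) (ha : ∀ i, a i ∈ (σ i).eval M m)
    {s : S} (t : Term Sg x s) : (t.subst σ).eval M m = t.eval M a := by
  induction t with
  | var i => exact Part.eq_some_iff.mpr (ha i)
  | app f t ih =>
    ext b
    rw [Term.subst, Term.mem_eval_app, Term.mem_eval_app]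
    simp only [ih]

lemma Formula.subst_holds (M : PStr Sg) {x y : Ctx κ S}
    (m : ∀ i : y.Pos, M.carrier (y.sort i)) (σ : ∀ i : x.Pos, Term Sg y (x.sort i))
    (a : ∀ i : x.Pos, M.carrier (x.sort i)) (ha : ∀ i, a i ∈ (σ i).eval M m)
    (φ : Formula Sg x) : (φ.subst σ).Holds M m ↔ φ.Holds M a := by
  induction φ with
  | rel R t => simp only [Formula.subst, Formula.Holds, Term.mem_eval_subst M m σ a ha]
  | eq t t' => simp only [Formula.subst, Formula.Holds, Term.mem_eval_subst M m σ a ha]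
  | conj α φ ih => simp only [Formula.subst, Formula.Holds, ih]

lemma Renaming.exists_eval {x z : Ctx κ S} (r : Renaming x z) (M : PStr Sg)
    (m : ∀ i : z.Pos, M.carrier (z.sort i)) (i : x.Pos) :
    ∃ a, a ∈ (r.term i : Term Sg z _).eval M m := by
  unfold Renaming.term
  generalize x.sort i = s, r.sort_eq i = h
  subst h
  exact ⟨_, Part.mem_some _⟩

/-- Soundness: theorems of `T` are valid in all models of `T`. -/
theorem Derivable.sound [Fact κ.IsRegular] {T : Theory Sg} {q : Sequent Sg}
    (h : Derivable T q) (M : PStr Sg) (hM : T.IsModel M) : q.Valid M := by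
  induction h with
  | ax q hq => exact hM q hq
  | id x φ => exact fun m hm => hm
  | cut x φ ψ χ _ _ ih₁ ih₂ => exact fun m hm => ih₂ m (ih₁ m hm)
  | subst x y φ ψ τ _ ih =>
    intro m hm
    obtain ⟨h₁, h₂⟩ := (Formula.and_holds M m _ _).mp hm
    choose a ha using fun i => (Term.defined_holds M m (τ i)).mp (h₂ i)
    exact (Formula.subst_holds M m τ a ha ψ).mpr
      (ih a ((Formula.subst_holds M m τ a ha φ).mp h₁))
  | refl x i => exact fun m _ => (Term.defined_holds M m _).mpr ⟨_, Part.mem_some _⟩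
  | eq x z a b φ =>
    intro m hm
    obtain ⟨h₁, h₂⟩ := (Formula.and_holds M m _ _).mp hm
    choose c hc using h₂
    exact (Formula.subst_holds M m _ c (fun i => (hc i).2) φ).mpr
      ((Formula.subst_holds M m _ c (fun i => (hc i).1) φ).mp h₁)
  | strictRel x R t j =>
    rintro m ⟨a, -, ha⟩
    exact (Term.defined_holds M m _).mpr ⟨_, ha j⟩
  | strictEqLeft x t t' =>
    rintro m ⟨a, ha, -⟩
    exact (Term.defined_holds M m _).mpr ⟨_, ha⟩
  | strictEqRight x t t' =>
    rintro m ⟨a, -, ha⟩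
    exact (Term.defined_holds M m _).mpr ⟨_, ha⟩
  | strictFun x f t j =>
    intro m hm
    obtain ⟨b, hb⟩ := (Term.defined_holds M m _).mp hm
    obtain ⟨a, ha, -⟩ := (Term.mem_eval_app M m f t b).mp hb
    exact (Term.defined_holds M m _).mpr ⟨_, ha j⟩
  | conjElim x α φ j => exact fun m hm => hm j
  | conjIntro x α φ ψ _ ih => exact fun m hm i => ih i m hm

end Semantics

/-! ## Theory morphisms -/

section Morphisms

variable {κ : Cardinal.{u}} {S S' : Type u} {Sg : Signature κ S} {Sg' : Signature κ S'}

/-- The data of a theory morphism: an assignment of sorts to sorts, of terms to function symbols and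
of formulas to relation symbols. -/
structure Translation (Sg : Signature κ S) (Sg' : Signature κ S') : Type u where
  onSort : S → S'
  onFun (f : Sg.Fun) : Term Sg' ((Sg.funArity f).map onSort) (onSort (Sg.funSort f))
  onRel (R : Sg.Rel) : Formula Sg' ((Sg.relArity R).map onSort)

/-- The translation of a term, replacing every function symbol `f` by the term assigned to it. -/
def Translation.term (ρ : Translation Sg Sg') {x : Ctx κ S} :
    {s : S} → Term Sg x s → Term Sg' (x.map ρ.onSort) (ρ.onSort s)
  | _, .var i => .var (x := x.map ρ.onSort) i
  | _, .app f t => (ρ.onFun f).subst (x := (Sg.funArity f).map ρ.onSort) (fun j => ρ.term (t j))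

/-- A formula saying that the translations of all proper subterms of a term are defined. It is
needed because a variable `x_j` of the term assigned to `f` need not occur in it, so that the
translation of `f(τ_j)_j` may be defined although the one of `τ_j` is not. If all
variables do occur, this formula follows from definedness of the translated term. -/
noncomputable def Translation.guard [Fact κ.IsRegular] (ρ : Translation Sg Sg') {x : Ctx κ S} :
    {s : S} → Term Sg x s → Formula Sg' (x.map ρ.onSort)
  | _, .var _ => Formula.truth
  | _, .app f t => .conj (Sg.funArity f).len
      (fun j => (ρ.guard (t j)).and (ρ.term (t j)).defined)

/-- The translation of a formula: every symbol is replaced by the term or formula assigned to it,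
and all subterms are required to be defined. -/
noncomputable def Translation.formula [Fact κ.IsRegular] (ρ : Translation Sg Sg') {x : Ctx κ S} :
    Formula Sg x → Formula Sg' (x.map ρ.onSort)
  | .rel R t => (Formula.conj (Sg.relArity R).len
        (fun j => (ρ.guard (t j)).and (ρ.term (t j)).defined)).and
      ((ρ.onRel R).subst (x := (Sg.relArity R).map ρ.onSort) (fun j => ρ.term (t j)))
  | .eq t t' => ((ρ.guard t).and (ρ.guard t')).and (.eq (ρ.term t) (ρ.term t'))
  | .conj α φ => .conj α (fun i => ρ.formula (φ i))

/-- The translation of a sequent. -/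
noncomputable def Translation.sequent [Fact κ.IsRegular] (ρ : Translation Sg Sg')
    (q : Sequent Sg) : Sequent Sg' :=
  ⟨q.ctx.map ρ.onSort, ρ.formula q.hyp, ρ.formula q.concl⟩

/-- A theory morphism: the translations of the axioms are theorems of the target theory. -/
structure TheoryMorphism [Fact κ.IsRegular] (T : Theory Sg) (T' : Theory Sg')
    extends Translation Sg Sg' where
  derivable : ∀ q ∈ T, Derivable T' (toTranslation.sequent q)

/-- The partial structure `U^ρ M`. -/
abbrev Translation.pullback (ρ : Translation Sg Sg') (M : PStr Sg') : PStr Sg where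
  carrier s := M.carrier (ρ.onSort s)
  func f a := (ρ.onFun f).eval M a
  rel R := {a | (ρ.onRel R).Holds M a}

lemma Translation.mem_eval_pullback [Fact κ.IsRegular] (ρ : Translation Sg Sg') (M : PStr Sg')
    {x : Ctx κ S} (m : ∀ i : x.Pos, M.carrier (ρ.onSort (x.sort i))) {s : S} (t : Term Sg x s)
    (b : M.carrier (ρ.onSort s)) :
    b ∈ t.eval (ρ.pullback M) m ↔
      (ρ.guard t).Holds (x := x.map ρ.onSort) M m ∧
        b ∈ (ρ.term t).eval (x := x.map ρ.onSort) M m := by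
  induction t with
  | var i =>
    refine ⟨fun h => ⟨fun j => ?_, h⟩, fun h => h.2⟩
    exact absurd j.2 (not_lt_natIdx_zero _)
  | app f t ih =>
    have hg : (ρ.guard (.app f t)).Holds (x := x.map ρ.onSort) M m ↔
        ∃ a : ∀ j : (Sg.funArity f).Pos, M.carrier (ρ.onSort ((Sg.funArity f).sort j)),
          ∀ j, a j ∈ (t j).eval (ρ.pullback M) m := by
      constructor
      · intro h
        have h' : ∀ j, ∃ a, a ∈ (t j).eval (ρ.pullback M) m := fun j => by
          obtain ⟨h₁, h₂⟩ := (Formula.and_holds M _ _ _).mp (h j)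
          obtain ⟨a, ha⟩ := (Term.defined_holds M _ _).mp h₂
          exact ⟨a, (ih j a).mpr ⟨h₁, ha⟩⟩
        choose a ha using h'
        exact ⟨a, ha⟩
      · rintro ⟨a, ha⟩ j
        have := (ih j _).mp (ha j)
        exact (Formula.and_holds M _ _ _).mpr
          ⟨this.1, (Term.defined_holds M _ _).mpr ⟨_, this.2⟩⟩
    rw [Term.mem_eval_app, hg]
    constructor
    · rintro ⟨a, ha, hb⟩
      refine ⟨⟨a, ha⟩, ?_⟩
      rw [Translation.term, Term.mem_eval_subst (x := (Sg.funArity f).map ρ.onSort) M _ _ a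
        (fun j => ((ih j _).mp (ha j)).2)]
      exact hb
    · rintro ⟨⟨a, ha⟩, hb⟩
      refine ⟨a, ha, ?_⟩
      rw [Translation.term, Term.mem_eval_subst (x := (Sg.funArity f).map ρ.onSort) M _ _ a
        (fun j => ((ih j _).mp (ha j)).2)] at hb
      exact hb

/-- The interpretation of `φ` in `U^ρ M` is the interpretation of the translation of `φ` in `M`. -/
lemma Translation.holds_pullback [Fact κ.IsRegular] (ρ : Translation Sg Sg') (M : PStr Sg')
    {x : Ctx κ S} (m : ∀ i : x.Pos, M.carrier (ρ.onSort (x.sort i))) (φ : Formula Sg x) :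
    φ.Holds (ρ.pullback M) m ↔ (ρ.formula φ).Holds (x := x.map ρ.onSort) M m := by
  induction φ with
  | rel R t =>
    rw [Translation.formula, Formula.and_holds]
    constructor
    · rintro ⟨a, ha, hat⟩
      have h' := fun j => (ρ.mem_eval_pullback M m (t j) _).mp (hat j)
      refine ⟨fun j => (Formula.and_holds M _ _ _).mpr
        ⟨(h' j).1, (Term.defined_holds M _ _).mpr ⟨_, (h' j).2⟩⟩, ?_⟩
      exact (Formula.subst_holds (x := (Sg.relArity R).map ρ.onSort) M _ _ a
        (fun j => (h' j).2) _).mpr ha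
    · rintro ⟨h₁, h₂⟩
      have h' : ∀ j, ∃ a, a ∈ (t j).eval (ρ.pullback M) m ∧
          a ∈ (ρ.term (t j)).eval (x := x.map ρ.onSort) M m := fun j => by
        obtain ⟨h₃, h₄⟩ := (Formula.and_holds M _ _ _).mp (h₁ j)
        obtain ⟨a, ha⟩ := (Term.defined_holds M _ _).mp h₄
        exact ⟨a, (ρ.mem_eval_pullback M m (t j) a).mpr ⟨h₃, ha⟩, ha⟩
      choose a ha ha' using h'
      exact ⟨a, (Formula.subst_holds (x := (Sg.relArity R).map ρ.onSort) M _ _ a ha' _).mp h₂, ha⟩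
  | eq t t' =>
    rw [Translation.formula, Formula.and_holds, Formula.and_holds]
    constructor
    · rintro ⟨a, ha, ha'⟩
      have h := (ρ.mem_eval_pullback M m t a).mp ha
      have h' := (ρ.mem_eval_pullback M m t' a).mp ha'
      exact ⟨⟨h.1, h'.1⟩, a, h.2, h'.2⟩
    · rintro ⟨⟨h, h'⟩, a, ha, ha'⟩
      exact ⟨a, (ρ.mem_eval_pullback M m t a).mpr ⟨h, ha⟩,
        (ρ.mem_eval_pullback M m t' a).mpr ⟨h', ha'⟩⟩
  | conj α φ ih => exact forall_congr' ih

/-- The translation functor `U^ρ` on partial structures. -/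
def Translation.functor (ρ : Translation Sg Sg') : PStr Sg' ⥤ PStr Sg where
  obj M := ρ.pullback M
  map {M N} h := PStr.Hom.mk (M := ρ.pullback M) (N := ρ.pullback N)
    (fun s => PStr.Hom.map h (ρ.onSort s))
    (fun f a b hb => Term.map_eval h a (ρ.onFun f) b hb)
    (fun R a ha => Formula.map_holds (x := (Sg.relArity R).map ρ.onSort) h a (ρ.onRel R) ha)

/-- The translation functor `U^ρ` on partial models. -/
def TheoryMorphism.U [Fact κ.IsRegular] {T : Theory Sg} {T' : Theory Sg'}
    (ρ : TheoryMorphism T T') : PMod T' ⥤ PMod T :=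
  (Theory.IsModel T).lift ((Theory.IsModel T').ι ⋙ ρ.toTranslation.functor) (fun M q hq m hm =>
    (ρ.toTranslation.holds_pullback M.obj m q.concl).mpr
      ((ρ.derivable q hq).sound M.obj M.property m
        ((ρ.toTranslation.holds_pullback M.obj m q.hyp).mp hm)))

/-- A `ρ`-relative judgment: a sequent over the target signature whose antecedent is the translation
of a formula over the source signature. -/
def TheoryMorphism.IsRelativeJudgment [Fact κ.IsRegular] {T : Theory Sg} {T' : Theory Sg'}
    (ρ : TheoryMorphism T T') (q : Sequent Sg') : Prop :=
  ∃ (x : Ctx κ S) (φ : Formula Sg x) (ψ : Formula Sg' (x.map ρ.onSort)),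
    q = ⟨x.map ρ.onSort, ρ.toTranslation.formula φ, ψ⟩

end Morphisms

end PHL

namespace PHL

open CategoryTheory Limits Opposite

section Induced

universe w

variable {κ : Cardinal.{u}} {S : Type u} {Sg : Signature κ S}

lemma Term.dom_eval_app (M : PStr Sg) {x : Ctx κ S} (m : ∀ i : x.Pos, M.carrier (x.sort i))
    (f : Sg.Fun) (t : ∀ j : (Sg.funArity f).Pos, Term Sg x ((Sg.funArity f).sort j)) :
    ((Term.app f t).eval M m).Dom ↔ ∃ a, (∀ j, a j ∈ (t j).eval M m) ∧ (M.func f a).Dom := by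
  simp only [Part.dom_iff_mem, Term.mem_eval_app]
  exact ⟨fun ⟨b, a, ha, hb⟩ => ⟨a, ha, b, hb⟩, fun ⟨a, ha, b, hb⟩ => ⟨b, a, ha, hb⟩⟩

/-- A family of homomorphisms out of `N` which is jointly injective and jointly reflects
definedness of function symbols and relations. -/
structure JointlyClosed {J : Type w} {N : PStr Sg} {A : J → PStr Sg} (h : ∀ j, N ⟶ A j) :
    Prop where
  inj : ∀ (s : S) (a b : N.carrier s), (∀ j, PStr.Hom.map (h j) s a = PStr.Hom.map (h j) s b) →
    a = b
  dom : ∀ (f : Sg.Fun) (a : ∀ i, N.carrier ((Sg.funArity f).sort i)),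
    (∀ j, ((A j).func f (fun i => PStr.Hom.map (h j) _ (a i))).Dom) → (N.func f a).Dom
  rel : ∀ (R : Sg.Rel) (a : ∀ i, N.carrier ((Sg.relArity R).sort i)),
    (∀ j, (fun i => PStr.Hom.map (h j) _ (a i)) ∈ (A j).rel R) → a ∈ N.rel R

namespace JointlyClosed

variable {J : Type w} {N : PStr Sg} {A : J → PStr Sg} {h : ∀ j, N ⟶ A j}

lemma dom_eval (hh : JointlyClosed h) {x : Ctx κ S} (m : ∀ i : x.Pos, N.carrier (x.sort i))
    {s : S} (t : Term Sg x s)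
    (ht : ∀ j, (t.eval (A j) (fun i => PStr.Hom.map (h j) _ (m i))).Dom) : (t.eval N m).Dom := by
  induction t with
  | var i => trivial
  | app f t ih =>
    have h' : ∀ i, ∃ a, a ∈ (t i).eval N m := fun i => Part.dom_iff_mem.mp (ih i fun j => by
      obtain ⟨a, ha, -⟩ := (Term.dom_eval_app _ _ _ _).mp (ht j)
      exact Part.dom_iff_mem.mpr ⟨_, ha i⟩)
    choose a ha using h'
    refine (Term.dom_eval_app _ _ _ _).mpr ⟨a, ha, hh.dom f a fun j => ?_⟩
    obtain ⟨b, hb, hd⟩ := (Term.dom_eval_app _ _ _ _).mp (ht j)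
    have : b = fun i => PStr.Hom.map (h j) _ (a i) :=
      funext fun i => Part.mem_unique (hb i) (Term.map_eval (h j) m (t i) _ (ha i))
    exact this ▸ hd

lemma mem_eval (hh : JointlyClosed h) {x : Ctx κ S} (m : ∀ i : x.Pos, N.carrier (x.sort i))
    {s : S} (t : Term Sg x s) (b : N.carrier s)
    (ht : ∀ j, PStr.Hom.map (h j) _ b ∈ t.eval (A j) (fun i => PStr.Hom.map (h j) _ (m i))) :
    b ∈ t.eval N m := by
  obtain ⟨c, hc⟩ := Part.dom_iff_mem.mp (hh.dom_eval m t fun j => Part.dom_iff_mem.mpr ⟨_, ht j⟩)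
  rwa [hh.inj s b c fun j => Part.mem_unique (ht j) (Term.map_eval (h j) m t c hc)]

lemma holds (hh : JointlyClosed h) {x : Ctx κ S} (m : ∀ i : x.Pos, N.carrier (x.sort i))
    (φ : Formula Sg x)
    (hφ : ∀ j, φ.Holds (A j) (fun i => PStr.Hom.map (h j) _ (m i))) : φ.Holds N m := by
  induction φ with
  | rel R t =>
    have h' : ∀ i, ∃ a, a ∈ (t i).eval N m := fun i => Part.dom_iff_mem.mp <|
      hh.dom_eval m (t i) fun j => by
        obtain ⟨a, -, ha⟩ := hφ j
        exact Part.dom_iff_mem.mpr ⟨_, ha i⟩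
    choose a ha using h'
    refine ⟨a, hh.rel R a fun j => ?_, ha⟩
    obtain ⟨b, hb, hb'⟩ := hφ j
    have : b = fun i => PStr.Hom.map (h j) _ (a i) :=
      funext fun i => Part.mem_unique (hb' i) (Term.map_eval (h j) m (t i) _ (ha i))
    exact this ▸ hb
  | eq t t' =>
    obtain ⟨b, hb⟩ := Part.dom_iff_mem.mp <| hh.dom_eval m t fun j => by
      obtain ⟨a, ha, -⟩ := hφ j
      exact Part.dom_iff_mem.mpr ⟨_, ha⟩
    refine ⟨b, hb, hh.mem_eval m t' b fun j => ?_⟩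
    obtain ⟨a, ha, ha'⟩ := hφ j
    rwa [Part.mem_unique (Term.map_eval (h j) m t b hb) ha]
  | conj α φ ih => exact fun i => ih i fun j => hφ j i

lemma mem_func (hh : JointlyClosed h) {f : Sg.Fun}
    {a : ∀ i, N.carrier ((Sg.funArity f).sort i)} {b : N.carrier (Sg.funSort f)}
    (hb : ∀ j, PStr.Hom.map (h j) _ b ∈ (A j).func f (fun i => PStr.Hom.map (h j) _ (a i))) :
    b ∈ N.func f a := by
  have hd := hh.dom f a fun j => Part.dom_iff_mem.mpr ⟨_, hb j⟩
  rw [hh.inj _ b _ fun j =>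
    Part.mem_unique (hb j) (PStr.Hom.map_func (h j) f a _ (Part.get_mem hd))]
  exact Part.get_mem hd

lemma isModel (hh : JointlyClosed h) {T : Theory Sg} (hA : ∀ j, T.IsModel (A j)) :
    T.IsModel N := fun q hq m hm =>
  hh.holds m q.concl fun j => hA j q hq _ (Formula.map_holds (h j) m q.hyp hm)

end JointlyClosed

/-- The largest structure on the carriers `K` for which all the maps `g j` are homomorphisms. -/
noncomputable def PStr.induced (K : S → Type u) {J : Type w} (A : J → PStr.{u} Sg)
    (g : ∀ j s, K s → (A j).carrier s) : PStr Sg where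
  carrier := K
  func f a := ⟨∃ c, ∀ j, g j _ c ∈ (A j).func f (fun i => g j _ (a i)), fun h => h.choose⟩
  rel R := {a | ∀ j, (fun i => g j _ (a i)) ∈ (A j).rel R}

section

variable {K : S → Type u} {J : Type w} {A : J → PStr.{u} Sg} {g : ∀ j s, K s → (A j).carrier s}

/-- The structure map of `PStr.induced`. -/
def PStr.inducedHom (g : ∀ j s, K s → (A j).carrier s) (j : J) : PStr.induced K A g ⟶ A j where
  map := g j
  map_func := by
    rintro f a b ⟨h, rfl⟩
    exact h.choose_spec j
  map_rel R a ha := ha j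

lemma PStr.mem_induced_func (hg : ∀ s (a b : K s), (∀ j, g j s a = g j s b) → a = b) {f : Sg.Fun}
    {a : ∀ i, K ((Sg.funArity f).sort i)} {b : K (Sg.funSort f)}
    (h : ∀ j, g j _ b ∈ (A j).func f (fun i => g j _ (a i))) :
    b ∈ (PStr.induced K A g).func f a :=
  ⟨⟨b, h⟩, hg _ _ _ fun j =>
    Part.mem_unique (PStr.Hom.map_func (PStr.inducedHom g j) f a _ (Part.get_mem _)) (h j)⟩

lemma PStr.jointlyClosed_inducedHom (hg : ∀ s (a b : K s), (∀ j, g j s a = g j s b) → a = b)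
    (hg' : ∀ (f : Sg.Fun) (a : ∀ i, K ((Sg.funArity f).sort i)),
      (∀ j, ((A j).func f (fun i => g j _ (a i))).Dom) →
        ∃ c, ∀ j, g j _ c ∈ (A j).func f (fun i => g j _ (a i))) :
    JointlyClosed (PStr.inducedHom g) where
  inj := hg
  dom := hg'
  rel _ _ h := h

/-- A family of maps whose composites with the structure maps are homomorphisms is a
homomorphism into the induced structure. -/
def PStr.inducedLift (hg : ∀ s (a b : K s), (∀ j, g j s a = g j s b) → a = b) {M : PStr Sg}
    (k : ∀ s, M.carrier s → K s) (h : ∀ j, M ⟶ A j)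
    (hk : ∀ j s a, g j s (k s a) = PStr.Hom.map (h j) s a) : M ⟶ PStr.induced K A g where
  map := k
  map_func f a b hb := PStr.mem_induced_func hg fun j => by
    simpa only [hk] using PStr.Hom.map_func (h j) f a b hb
  map_rel R a ha j := by
    simpa only [hk] using PStr.Hom.map_rel (h j) R a ha

end

variable {T : Theory Sg}

@[ext]
lemma PMod.hom_ext {M N : PMod T} {h k : M ⟶ N} (e : ∀ s a, h.hom.map s a = k.hom.map s a) :
    h = k :=
  ObjectProperty.hom_ext _ (PStr.Hom.ext (funext fun s => funext fun a => e s a))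

lemma PMod.congr_map {M N : PMod T} {h k : M ⟶ N} (e : h = k) {s : S} (a : M.obj.carrier s) :
    h.hom.map s a = k.hom.map s a := by rw [e]

lemma PMod.mono_of_injective {M N : PMod T} (h : M ⟶ N)
    (hh : ∀ s, Function.Injective (h.hom.map s)) : Mono h where
  right_cancellation _ _ e := PMod.hom_ext fun s a => hh s (PMod.congr_map e a)

/-! ### Products and closed substructures -/

lemma PMod.exists_product {J : Type u} (A : J → PMod T) :
    ∃ c : Fan A, Nonempty (IsLimit c) ∧ JointlyClosed (fun j => (c.proj j).hom) ∧
      ∀ (s : S) (a : ∀ j, (A j).obj.carrier s), ∃ b, ∀ j, (c.proj j).hom.map s b = a j := by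
  let g : ∀ j s, (∀ j, (A j).obj.carrier s) → (A j).obj.carrier s := fun j s a => a j
  have hg : ∀ s (a b : ∀ j, (A j).obj.carrier s), (∀ j, g j s a = g j s b) → a = b :=
    fun s a b => funext
  have hc : JointlyClosed (PStr.inducedHom (A := fun j => (A j).obj) g) :=
    PStr.jointlyClosed_inducedHom hg fun f a h =>
      ⟨fun j => ((A j).obj.func f _).get (h j), fun j => Part.get_mem _⟩
  let N : PMod T := ⟨_, hc.isModel fun j => (A j).property⟩
  let c : Fan A := Fan.mk N fun j => ObjectProperty.homMk (PStr.inducedHom g j)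
  refine ⟨c, ⟨Fan.IsLimit.mk _ (fun s => ObjectProperty.homMk (PStr.inducedLift hg
    (fun t a j => (s.proj j).hom.map t a) (fun j => (s.proj j).hom) fun j t a => rfl))
      (fun s j => rfl) fun s m hm => ?_⟩, hc, fun s a => ⟨a, fun j => rfl⟩⟩
  ext t a
  exact funext fun j => PMod.congr_map (hm j) a

/-- The closed submodel carried by a family of subsets that is closed under the partial
operations. -/
lemma PMod.exists_closedSubmodel (B : PMod T) (P : ∀ s, B.obj.carrier s → Prop)
    (hP : ∀ (f : Sg.Fun) (a) (b), b ∈ B.obj.func f a → (∀ i, P _ (a i)) → P _ b) :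
    ∃ (C : PMod T) (m : C ⟶ B), IsClosedMono m ∧ (∀ s c, P s (m.hom.map s c)) ∧
      ∀ (A : PMod T) (h : A ⟶ B), (∀ s a, P s (h.hom.map s a)) → ∃ g : A ⟶ C, g ≫ m = h := by
  let g : ∀ (_ : PUnit.{1}) (s), {b : B.obj.carrier s // P s b} → B.obj.carrier s :=
    fun _ s a => a.1
  have hg : ∀ s (a b : {b : B.obj.carrier s // P s b}), (∀ j, g j s a = g j s b) → a = b :=
    fun s a b h => Subtype.ext (h ⟨⟩)
  have hc : JointlyClosed (PStr.inducedHom (A := fun _ => B.obj) g) :=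
    PStr.jointlyClosed_inducedHom hg fun f a h =>
      ⟨⟨_, hP f _ _ (Part.get_mem (h ⟨⟩)) fun i => (a i).2⟩, fun j => Part.get_mem _⟩
  let C : PMod T := ⟨_, hc.isModel fun _ => B.property⟩
  let m : C ⟶ B := ObjectProperty.homMk (PStr.inducedHom g ⟨⟩)
  refine ⟨C, m, ⟨PMod.mono_of_injective m fun s a b h => Subtype.ext h,
    fun f a h => hc.dom f a fun _ => h, fun R a h => hc.rel R a fun _ => h⟩, fun s c => c.2,
    fun A h hh => ⟨ObjectProperty.homMk (PStr.inducedLift hg (fun s a => ⟨h.hom.map s a, hh s a⟩)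
      (fun _ => h.hom) fun _ _ _ => rfl), rfl⟩⟩

end Induced

section Universal

variable {κ : Cardinal.{u}} {S : Type u} {Sg : Signature κ S}

/-- Terms over a family of variables of arbitrary size. -/
inductive FreeTerm (Sg : Signature κ S) {ι : Type u} (σ : ι → S) : S → Type u
  | var (i : ι) : FreeTerm Sg σ (σ i)
  | app (f : Sg.Fun)
      (t : ∀ j : (Sg.funArity f).Pos, FreeTerm Sg σ ((Sg.funArity f).sort j)) :
      FreeTerm Sg σ (Sg.funSort f)

variable {ι : Type u} {σ : ι → S}

/-- The value of a term over a family of variables. -/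
def FreeTerm.eval (M : PStr Sg) (m : ∀ i, M.carrier (σ i)) :
    {s : S} → FreeTerm Sg σ s → Part (M.carrier s)
  | _, .var i => Part.some (m i)
  | _, .app f t =>
      (Part.mk (∀ j, ((t j).eval M m).Dom) (fun h j => ((t j).eval M m).get (h j))).bind (M.func f)

lemma FreeTerm.mem_eval_app (M : PStr Sg) (m : ∀ i, M.carrier (σ i)) (f : Sg.Fun)
    (t : ∀ j : (Sg.funArity f).Pos, FreeTerm Sg σ ((Sg.funArity f).sort j))
    (b : M.carrier (Sg.funSort f)) :
    b ∈ (FreeTerm.app f t).eval M m ↔ ∃ a, (∀ j, a j ∈ (t j).eval M m) ∧ b ∈ M.func f a := by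
  rw [FreeTerm.eval]
  refine Part.mem_bind_iff.trans ⟨?_, ?_⟩
  · rintro ⟨_, ⟨ha, rfl⟩, hb⟩
    exact ⟨_, fun j => Part.get_mem (ha j), hb⟩
  · rintro ⟨a, ha, hb⟩
    exact ⟨a, ⟨fun j => (ha j).1, funext fun j => (ha j).2⟩, hb⟩

variable {T : Theory Sg}

/-- `N` with the generators `n` is universal among the models in `E` with a family of elements
that satisfies the condition `Cnd`. -/
structure IsUniversal (E : ObjectProperty (PMod T)) (σ : ι → S)
    (Cnd : ∀ A : PMod T, (∀ i, A.obj.carrier (σ i)) → Prop) (N : PMod T)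
    (n : ∀ i, N.obj.carrier (σ i)) : Prop where
  prop : E N
  exists_hom : ∀ (A : PMod T) (a), E A → Cnd A a →
    ∃ h : N ⟶ A, (fun i => h.hom.map _ (n i)) = a
  induction : ∀ P : ∀ s, N.obj.carrier s → Prop, (∀ i, P _ (n i)) →
    (∀ (f : Sg.Fun) (a) (b), b ∈ N.obj.func f a → (∀ i, P _ (a i)) → P _ b) → ∀ s a, P s a
  jointlyClosed : JointlyClosed
    (J := {p : Σ A : PMod T, N ⟶ A // E p.1 ∧ Cnd p.1 (fun i => p.2.hom.map _ (n i))})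
    (fun p => p.1.2.hom)

lemma IsUniversal.hom_ext {E : ObjectProperty (PMod T)} {Cnd} {N : PMod T} {n}
    (hN : IsUniversal E σ Cnd N n) {A : PMod T} {h k : N ⟶ A}
    (e : ∀ i, h.hom.map _ (n i) = k.hom.map _ (n i)) : h = k := by
  ext s a
  revert s a
  refine hN.induction _ e fun f a b hb ih => ?_
  refine Part.mem_unique (PStr.Hom.map_func h.hom f a b hb) ?_
  rw [show (fun j => h.hom.map _ (a j)) = fun j => k.hom.map _ (a j) from funext ih]
  exact PStr.Hom.map_func k.hom f a b hb

lemma IsUniversal.holds {E : ObjectProperty (PMod T)} {Cnd} {N : PMod T} {n}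
    (hN : IsUniversal E σ Cnd N n) {x : Ctx κ S} (φ : Formula Sg x)
    (m : ∀ i : x.Pos, N.obj.carrier (x.sort i))
    (hφ : ∀ (A : PMod T) (h : N ⟶ A), E A → Cnd A (fun i => h.hom.map _ (n i)) →
      φ.Holds A.obj (fun i => h.hom.map _ (m i))) : φ.Holds N.obj m :=
  hN.jointlyClosed.holds m φ fun p => hφ p.1.1 p.1.2 p.2.1 p.2.2

lemma IsUniversal.holds_generic {E : ObjectProperty (PMod T)} {x : Ctx κ S} {φ : Formula Sg x}
    {N : PMod T} {n} (hN : IsUniversal E x.sort (fun A a => φ.Holds A.obj a) N n) :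
    φ.Holds N.obj n :=
  hN.holds φ n fun _ _ _ h => h

/-- A model with a jointly closed family of homomorphisms to members of a class closed under
products and closed submodels belongs to this class. -/
lemma JointlyClosed.prop_of_forall (E : ObjectProperty (PMod T))
    (hprod : ∀ J : Type u, E.IsClosedUnderLimitsOfShape (Discrete J))
    (hsub : ∀ ⦃M N : PMod T⦄ (m : M ⟶ N), IsClosedMono m → E N → E M)
    {J : Type*} {N : PMod T} {A : J → PMod T} {h : ∀ j, N ⟶ A j}
    (hh : JointlyClosed (fun j => (h j).hom)) (hA : ∀ j, E (A j)) : E N := by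
  let I₁ : Type u := Σ s, {p : N.obj.carrier s × N.obj.carrier s // p.1 ≠ p.2}
  let I₂ : Type u :=
    Σ f, {a : ∀ i, N.obj.carrier ((Sg.funArity f).sort i) // ¬ (N.obj.func f a).Dom}
  let I₃ : Type u := Σ R, {a : ∀ i, N.obj.carrier ((Sg.relArity R).sort i) // a ∉ N.obj.rel R}
  have h₁ : ∀ i : I₁, ∃ j, (h j).hom.map _ i.2.1.1 ≠ (h j).hom.map _ i.2.1.2 := fun i => by
    by_contra! h'
    exact i.2.2 (hh.inj _ _ _ h')
  have h₂ : ∀ i : I₂, ∃ j, ¬ ((A j).obj.func i.1 (fun k => (h j).hom.map _ (i.2.1 k))).Dom :=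
    fun i => by
      by_contra! h'
      exact i.2.2 (hh.dom _ _ h')
  have h₃ : ∀ i : I₃, ∃ j, (fun k => (h j).hom.map _ (i.2.1 k)) ∉ (A j).obj.rel i.1 :=
    fun i => by
      by_contra! h'
      exact i.2.2 (hh.rel _ _ h')
  choose j₁ hj₁ using h₁
  choose j₂ hj₂ using h₂
  choose j₃ hj₃ using h₃
  let j : I₁ ⊕ I₂ ⊕ I₃ → J := Sum.elim j₁ (Sum.elim j₂ j₃)
  obtain ⟨c, ⟨hc⟩, -, -⟩ := PMod.exists_product fun i => A (j i)
  let m : N ⟶ c.pt := Fan.IsLimit.lift hc fun i => h (j i)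
  have hm : ∀ i s a, (c.proj i).hom.map s (m.hom.map s a) = (h (j i)).hom.map s a :=
    fun i s a => PMod.congr_map (Fan.IsLimit.fac hc _ i) a
  have hEc : E c.pt := E.prop_of_isLimit hc fun i => hA _
  refine hsub m ⟨PMod.mono_of_injective m fun s a b e => ?_, fun f a hd => ?_, fun R a ha => ?_⟩ hEc
  · by_contra hab
    refine hj₁ ⟨s, (a, b), hab⟩ ?_
    have := hm (.inl ⟨s, (a, b), hab⟩) s
    exact (this a).symm.trans ((congrArg _ e).trans (this b))
  · by_contra hf
    refine hj₂ ⟨f, a, hf⟩ ?_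
    have := hm (.inr (.inl ⟨f, a, hf⟩))
    have h' := PStr.Hom.map_func (c.proj (.inr (.inl ⟨f, a, hf⟩))).hom f _ _ (Part.get_mem hd)
    simp only [this] at h'
    exact Part.dom_iff_mem.mpr ⟨_, h'⟩
  · by_contra hR
    refine hj₃ ⟨R, a, hR⟩ ?_
    have := hm (.inr (.inr ⟨R, a, hR⟩))
    have h' := PStr.Hom.map_rel (c.proj (.inr (.inr ⟨R, a, hR⟩))).hom R _ ha
    simp only [this] at h'
    exact h'

theorem exists_isUniversal (E : ObjectProperty (PMod T))
    (hprod : ∀ J : Type u, E.IsClosedUnderLimitsOfShape (Discrete J))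
    (hsub : ∀ ⦃M N : PMod T⦄ (m : M ⟶ N), IsClosedMono m → E N → E M) (σ : ι → S)
    (Cnd : ∀ A : PMod T, (∀ i, A.obj.carrier (σ i)) → Prop) :
    ∃ N n, IsUniversal E σ Cnd N n := by
  let J := {p : Σ A : PMod T, ∀ i, A.obj.carrier (σ i) // E p.1 ∧ Cnd p.1 p.2}
  let A : J → PStr Sg := fun j => j.1.1.obj
  let r : ∀ s, Setoid {t : FreeTerm Sg σ s // ∀ j : J, (t.eval (A j) j.1.2).Dom} := fun s =>
    { r := fun t t' => ∀ j : J, t.1.eval (A j) j.1.2 = t'.1.eval (A j) j.1.2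
      iseqv := ⟨fun _ _ => rfl, fun h j => (h j).symm, fun h h' j => (h j).trans (h' j)⟩ }
  let K : S → Type u := fun s => Quotient (r s)
  let g : ∀ j s, K s → (A j).carrier s := fun j s =>
    Quotient.lift (fun t => (t.1.eval (A j) j.1.2).get (t.2 j))
      fun t t' h => by simp only [h j]
  have hg : ∀ s (a b : K s), (∀ j, g j s a = g j s b) → a = b := by
    intro s a b
    refine Quotient.inductionOn₂ a b fun t t' h => Quotient.sound fun j => ?_
    exact Part.eq_of_get_eq_get (t.2 j) (t'.2 j) (h j)
  have hmk : ∀ j s t ht, g j s (Quotient.mk (r s) ⟨t, ht⟩) ∈ t.eval (A j) j.1.2 :=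
    fun j s t ht => Part.get_mem _
  have happ : ∀ (f : Sg.Fun) (a : ∀ i, K ((Sg.funArity f).sort i))
      (t : ∀ i, FreeTerm Sg σ ((Sg.funArity f).sort i)),
      (∀ i j, g j _ (a i) ∈ (t i).eval (A j) j.1.2) →
      (∀ j, ((A j).func f (fun i => g j _ (a i))).Dom) →
      ∃ ht, ∀ j, g j _ (Quotient.mk (r _) ⟨.app f t, ht⟩) ∈
        (A j).func f (fun i => g j _ (a i)) := by
    intro f a t ha hd
    have : ∀ j, ((A j).func f (fun i => g j _ (a i))).get (hd j) ∈
        (FreeTerm.app f t).eval (A j) j.1.2 := fun j =>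
      (FreeTerm.mem_eval_app _ _ _ _ _).mpr ⟨_, fun i => ha i j, Part.get_mem _⟩
    refine ⟨fun j => Part.dom_iff_mem.mpr ⟨_, this j⟩, fun j => ?_⟩
    rw [Part.mem_unique (hmk j _ _ _) (this j)]
    exact Part.get_mem _
  have hc : JointlyClosed (PStr.inducedHom (A := A) g) := by
    refine PStr.jointlyClosed_inducedHom hg fun f a hd => ?_
    choose t ht using fun i => Quotient.exists_rep (a i)
    obtain ⟨ht, h⟩ := happ f a (fun i => (t i).1) (fun i j => by
      rw [← ht i]
      exact hmk j _ _ _) hd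
    exact ⟨_, h⟩
  let N : PMod T := ⟨_, hc.isModel fun j => j.1.1.property⟩
  let h : ∀ j : J, N ⟶ j.1.1 := fun j => ObjectProperty.homMk (PStr.inducedHom g j)
  let n : ∀ i, K (σ i) := fun i => Quotient.mk _ ⟨.var i, fun j => trivial⟩
  refine ⟨N, n, JointlyClosed.prop_of_forall E hprod hsub (h := h) hc fun j => j.2.1,
    fun B a hB ha => ⟨h ⟨⟨B, a⟩, hB, ha⟩, rfl⟩, fun P hP hP' => ?_, ?_⟩
  · have key : ∀ s (t : FreeTerm Sg σ s) ht, P s (Quotient.mk (r s) ⟨t, ht⟩) := by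
      intro s t
      induction t with
      | var i => exact fun ht => hP i
      | app f t ih =>
        intro ht
        have hsubt : ∀ i (j : J), ((t i).eval (A j) j.1.2).Dom := fun i j => by
          obtain ⟨b, hb⟩ := Part.dom_iff_mem.mp (ht j)
          obtain ⟨a, ha, -⟩ := (FreeTerm.mem_eval_app _ _ _ _ _).mp hb
          exact Part.dom_iff_mem.mpr ⟨_, ha i⟩
        refine hP' f (fun i => Quotient.mk (r _) ⟨t i, hsubt i⟩) _
          (PStr.mem_induced_func hg fun j => ?_) fun i => ih i _
        obtain ⟨a, ha, hb⟩ := (FreeTerm.mem_eval_app _ _ _ _ _).mp (hmk j _ _ ht)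
        rwa [show a = fun i => g j _ (Quotient.mk (r _) ⟨t i, hsubt i⟩) from
          funext fun i => Part.mem_unique (ha i) (hmk j _ _ _)] at hb
    exact fun s => Quotient.ind fun t => key s t.1 t.2
  · let k : J → {p : Σ A : PMod T, N ⟶ A // E p.1 ∧ Cnd p.1 (fun i => p.2.hom.map _ (n i))} :=
      fun j => ⟨⟨j.1.1, h j⟩, j.2⟩
    exact ⟨fun s a b e => hc.inj s a b fun j => e (k j), fun f a e => hc.dom f a fun j => e (k j),
      fun R a e => hc.rel R a fun j => e (k j)⟩

theorem exists_isUniversal_top (T : Theory Sg) (σ : ι → S)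
    (Cnd : ∀ A : PMod T, (∀ i, A.obj.carrier (σ i)) → Prop) :
    ∃ N n, IsUniversal ⊤ σ Cnd N n :=
  exists_isUniversal ⊤ (fun _ => inferInstance) (fun _ _ _ _ _ => trivial) σ Cnd

lemma PMod.injective_of_mono {M N : PMod T} (h : M ⟶ N) [Mono h] (s : S) :
    Function.Injective (h.hom.map s) := by
  intro a b e
  obtain ⟨F, n, hF⟩ := exists_isUniversal_top T (fun _ : PUnit.{u + 1} => s) fun _ _ => True
  obtain ⟨k, hk⟩ := hF.exists_hom M (fun _ => a) trivial trivial
  obtain ⟨l, hl⟩ := hF.exists_hom M (fun _ => b) trivial trivial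
  have hk : k.hom.map s (n ⟨⟩) = a := congrFun hk ⟨⟩
  have hl : l.hom.map s (n ⟨⟩) = b := congrFun hl ⟨⟩
  have : k = l := by
    rw [← cancel_mono h]
    refine hF.hom_ext fun _ => ?_
    change h.hom.map s (k.hom.map s _) = h.hom.map s (l.hom.map s _)
    rw [hk, hl, e]
  rw [← hk, ← hl, this]

lemma IsClosedMono.jointlyClosed {M N : PMod T} {m : M ⟶ N} (hm : IsClosedMono m) :
    JointlyClosed (fun _ : PUnit.{1} => m.hom) where
  inj s _ _ h := have := hm.mono; PMod.injective_of_mono m s (h ⟨⟩)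
  dom f a h := hm.dom_of_dom f a (h ⟨⟩)
  rel R a h := hm.rel_of_rel R a (h ⟨⟩)

lemma IsClosedMono.holds {M N : PMod T} {m : M ⟶ N} (hm : IsClosedMono m) {x : Ctx κ S}
    (a : ∀ i : x.Pos, M.obj.carrier (x.sort i)) (φ : Formula Sg x)
    (h : φ.Holds N.obj (fun i => m.hom.map _ (a i))) : φ.Holds M.obj a :=
  hm.jointlyClosed.holds a φ fun _ => h

/-- Dense morphisms are epimorphisms. -/
lemma IsDense.epi {A B : PMod T} {h : A ⟶ B} (hh : IsDense h) : Epi h where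
  left_cancellation {N} u v e := by
    obtain ⟨C, m, hm, hP, hl⟩ := PMod.exists_closedSubmodel B
      (fun s b => u.hom.map s b = v.hom.map s b) fun f a b hb ih => by
        refine Part.mem_unique (PStr.Hom.map_func u.hom f a b hb) ?_
        rw [show (fun j => u.hom.map _ (a j)) = fun j => v.hom.map _ (a j) from funext ih]
        exact PStr.Hom.map_func v.hom f a b hb
    have := hh m hm (hl A h fun s a => PMod.congr_map e a)
    rw [← cancel_epi m]
    exact PMod.hom_ext hP

/-- Dense morphisms are left orthogonal to closed monomorphisms. -/
lemma IsDense.exists_lift {A B M N : PMod T} {e : A ⟶ B} (he : IsDense e) {m : M ⟶ N}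
    (hm : IsClosedMono m) (g : A ⟶ M) (k : B ⟶ N) (h : g ≫ m = e ≫ k) :
    ∃ l : B ⟶ M, e ≫ l = g := by
  have hinj := hm.jointlyClosed.inj
  obtain ⟨C, i, hi, hP, hl⟩ := PMod.exists_closedSubmodel B
    (fun s b => ∃ a, m.hom.map s a = k.hom.map s b) fun f b c hc hb => by
      choose a ha using hb
      have h' := PStr.Hom.map_func k.hom f b c hc
      rw [← show (fun j => m.hom.map _ (a j)) = fun j => k.hom.map _ (b j) from funext ha] at h'
      have hd := hm.dom_of_dom f a (Part.dom_iff_mem.mpr ⟨_, h'⟩)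
      exact ⟨_, Part.mem_unique (PStr.Hom.map_func m.hom f a _ (Part.get_mem hd)) h'⟩
  have hiso := he i hi (hl A e fun s a => ⟨g.hom.map s a, PMod.congr_map h a⟩)
  have hB : ∀ s (b : B.obj.carrier s), ∃ a, m.hom.map s a = k.hom.map s b := fun s b => by
    have := hP s ((inv i).hom.map s b)
    rwa [show i.hom.map s ((inv i).hom.map s b) = b from
      PMod.congr_map (IsIso.inv_hom_id i) b] at this
  choose l hl using hB
  have hinj' : ∀ s a b, m.hom.map s a = m.hom.map s b → a = b := fun s a b e =>
    hinj s a b fun _ => e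
  refine ⟨ObjectProperty.homMk ⟨l, fun f b c hc => ?_, fun R b hb => ?_⟩, ?_⟩
  · refine hm.jointlyClosed.mem_func fun _ => ?_
    simp only [hl]
    exact PStr.Hom.map_func k.hom f b c hc
  · refine hm.rel_of_rel R _ ?_
    simp only [hl]
    exact PStr.Hom.map_rel k.hom R b hb
  · ext s a
    exact hinj' _ _ _ ((hl _ _).trans (PMod.congr_map h a).symm)

lemma IsDense.bijective_of_exists {A B M : PMod T} {e : A ⟶ B} (he : IsDense e)
    (h : ∀ g : A ⟶ M, ∃ g' : B ⟶ M, e ≫ g' = g) :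
    Function.Bijective (fun g : B ⟶ M => e ≫ g) :=
  have := he.epi
  ⟨fun _ _ h => (cancel_epi e).mp h, h⟩

end Universal

section FilteredColimits

variable {κ : Cardinal.{u}} {S : Type u} {Sg : Signature κ S}

lemma hasCardinalLT_Iio (α : κ.ord.ToType) : HasCardinalLT (Set.Iio α) κ := by
  rw [hasCardinalLT_iff_cardinal_mk_lt]
  exact by simpa using Cardinal.mk_Iio_lt α

variable {J : Type u} [SmallCategory J]

/-- The injections of a cocone of partial structures. -/
abbrev PStr.leg {D : J ⥤ PStr Sg} (c : Cocone D) (j : J) (s : S) :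
    (D.obj j).carrier s → c.pt.carrier s := PStr.Hom.map (c.ι.app j) s

/-- The transition maps of a diagram of partial structures. -/
abbrev PStr.trans (D : J ⥤ PStr Sg) {j k : J} (u : j ⟶ k) (s : S) :
    (D.obj j).carrier s → (D.obj k).carrier s := PStr.Hom.map (D.map u) s

lemma PStr.leg_trans {D : J ⥤ PStr Sg} (c : Cocone D) {j k : J} (u : j ⟶ k) {s : S}
    (a : (D.obj j).carrier s) : PStr.leg c k s (PStr.trans D u s a) = PStr.leg c j s a := by
  have : PStr.Hom.map (D.map u ≫ c.ι.app k) s a = PStr.Hom.map (c.ι.app j) s a := by rw [c.w u]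
  exact this

lemma PStr.trans_comp (D : J ⥤ PStr Sg) {j k l : J} (u : j ⟶ k) (v : k ⟶ l) {s : S}
    (a : (D.obj j).carrier s) :
    PStr.trans D (u ≫ v) s a = PStr.trans D v s (PStr.trans D u s a) := by
  have : PStr.Hom.map (D.map (u ≫ v)) s a = PStr.Hom.map (D.map u ≫ D.map v) s a := by
    rw [D.map_comp]
  exact this

/-- A cocone over a `κ`-filtered diagram of partial structures which is a colimit on carriers, and
in which every valid atomic fact already holds at some stage. -/
structure IsConcreteColimit {D : J ⥤ PStr Sg} (c : Cocone D) : Prop where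
  surj : ∀ (s : S) (b : c.pt.carrier s), ∃ j a, PStr.leg c j s a = b
  inj : ∀ (j : J) (s : S) (a a'), PStr.leg c j s a = PStr.leg c j s a' →
    ∃ (k : J) (u : j ⟶ k), PStr.trans D u s a = PStr.trans D u s a'
  func : ∀ (f : Sg.Fun) (j : J) (a : ∀ i, (D.obj j).carrier ((Sg.funArity f).sort i)) (b),
    b ∈ c.pt.func f (fun i => PStr.leg c j _ (a i)) →
    ∃ (k : J) (u : j ⟶ k), ∃ b' ∈ (D.obj k).func f (fun i => PStr.trans D u _ (a i)),
      PStr.leg c k _ b' = b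
  rel : ∀ (R : Sg.Rel) (j : J) (a : ∀ i, (D.obj j).carrier ((Sg.relArity R).sort i)),
    (fun i => PStr.leg c j _ (a i)) ∈ c.pt.rel R →
    ∃ (k : J) (u : j ⟶ k), (fun i => PStr.trans D u _ (a i)) ∈ (D.obj k).rel R

lemma IsConcreteColimit.of_iso {D : J ⥤ PStr Sg} {c c' : Cocone D} (hc : IsConcreteColimit c)
    (e : c ≅ c') : IsConcreteColimit c' := by
  have h₁ : ∀ j s a, PStr.Hom.map e.hom.hom s (PStr.leg c j s a) = PStr.leg c' j s a :=
    fun j s a => congrArg (fun h => PStr.Hom.map h s a) (e.hom.w j)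
  have h₂ : ∀ j s a, PStr.Hom.map e.inv.hom s (PStr.leg c' j s a) = PStr.leg c j s a :=
    fun j s a => congrArg (fun h => PStr.Hom.map h s a) (e.inv.w j)
  have h₃ : ∀ s a, PStr.Hom.map e.hom.hom s (PStr.Hom.map e.inv.hom s a) = a :=
    fun s a => congrArg (fun h => PStr.Hom.map (CoconeMorphism.hom h) s a) e.inv_hom_id
  refine ⟨fun s b => ?_, fun j s a a' h => hc.inj j s a a' ?_, fun f j a b hb => ?_,
    fun R j a h => hc.rel R j a ?_⟩
  · obtain ⟨j, a, ha⟩ := hc.surj s (PStr.Hom.map e.inv.hom s b)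
    exact ⟨j, a, by rw [← h₁, ha, h₃]⟩
  · rw [← h₂, ← h₂, h]
  · have := PStr.Hom.map_func e.inv.hom f _ _ hb
    simp only [h₂] at this
    obtain ⟨k, u, b', hb', e'⟩ := hc.func f j a _ this
    exact ⟨k, u, b', hb', by rw [← h₁, e', h₃]⟩
  · have := PStr.Hom.map_rel e.inv.hom R _ h
    simpa only [h₂] using this

variable [Fact κ.IsRegular] [IsCardinalFiltered J κ]

lemma PStr.exists_trans_eq {D : J ⥤ PStr Sg} {K : S → Type u}
    (ι : ∀ j s, (D.obj j).carrier s → K s)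
    (hι : ∀ {j k} (u : j ⟶ k) s a, ι k s (PStr.trans D u s a) = ι j s a)
    (hinj : ∀ j s a a', ι j s a = ι j s a' →
      ∃ (k : J) (u : j ⟶ k), PStr.trans D u s a = PStr.trans D u s a')
    {I : Type u} (hI : HasCardinalLT I κ) {s : I → S} {j k : J}
    (a : ∀ i, (D.obj j).carrier (s i)) (a' : ∀ i, (D.obj k).carrier (s i))
    (h : ∀ i, ι j (s i) (a i) = ι k (s i) (a' i)) :
    ∃ (l : J) (u : j ⟶ l) (v : k ⟶ l),
      ∀ i, PStr.trans D u _ (a i) = PStr.trans D v _ (a' i) := by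
  have := isFiltered_of_isCardinalFiltered J κ
  let u₀ := IsFiltered.leftToMax j k
  let v₀ := IsFiltered.rightToMax j k
  choose l w hw using fun i => hinj _ (s i) (PStr.trans D u₀ _ (a i)) (PStr.trans D v₀ _ (a' i))
    (by rw [hι, hι, h i])
  obtain ⟨m, p, q, hpq⟩ := IsCardinalFiltered.wideSpan w hI
  refine ⟨m, u₀ ≫ q, v₀ ≫ q, fun i => ?_⟩
  rw [← hpq i, PStr.trans_comp, PStr.trans_comp, PStr.trans_comp, PStr.trans_comp, hw i]

namespace IsConcreteColimit

variable {D : J ⥤ PStr Sg} {c : Cocone D}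

lemma exists_family (hc : IsConcreteColimit c) {I : Type u} (hI : HasCardinalLT I κ)
    {s : I → S} (b : ∀ i, c.pt.carrier (s i)) :
    ∃ (j : J) (a : ∀ i, (D.obj j).carrier (s i)), ∀ i, PStr.leg c j _ (a i) = b i := by
  choose j a ha using fun i => hc.surj (s i) (b i)
  refine ⟨_, fun i => PStr.trans D (IsCardinalFiltered.toMax j hI i) _ (a i), fun i => ?_⟩
  rw [PStr.leg_trans, ha]

lemma exists_trans_eq (hc : IsConcreteColimit c) {I : Type u} (hI : HasCardinalLT I κ)
    {s : I → S} {j k : J} (a : ∀ i, (D.obj j).carrier (s i)) (a' : ∀ i, (D.obj k).carrier (s i))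
    (h : ∀ i, PStr.leg c j _ (a i) = PStr.leg c k _ (a' i)) :
    ∃ (l : J) (u : j ⟶ l) (v : k ⟶ l),
      ∀ i, PStr.trans D u _ (a i) = PStr.trans D v _ (a' i) :=
  PStr.exists_trans_eq (PStr.leg c) (fun u _ => PStr.leg_trans c u) hc.inj hI a a' h

/-- A `κ`-small family of facts about elements at stage `j`, each of which holds at some later
stage, holds at a common later stage. -/
lemma exists_common_stage {I : Type u} (hI : HasCardinalLT I κ) {j : J}
    (P : ∀ (_ : I) (k : J), (j ⟶ k) → Prop)
    (hP : ∀ i k l (u : j ⟶ k) (v : k ⟶ l), P i k u → P i l (u ≫ v))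
    (h : ∀ i, ∃ k u, P i k u) : ∃ k u, ∀ i, P i k u := by
  choose k u hu using h
  obtain ⟨m, p, q, hpq⟩ := IsCardinalFiltered.wideSpan u hI
  exact ⟨m, q, fun i => hpq i ▸ hP i _ _ _ (p i) (hu i)⟩

lemma exists_mem_eval (hc : IsConcreteColimit c) {x : Ctx κ S} {j : J}
    (m : ∀ i : x.Pos, (D.obj j).carrier (x.sort i)) {s : S} (t : Term Sg x s)
    (b : c.pt.carrier s) (hb : b ∈ t.eval c.pt (fun i => PStr.leg c j _ (m i))) :
    ∃ (k : J) (u : j ⟶ k), ∃ b' ∈ t.eval (D.obj k) (fun i => PStr.trans D u _ (m i)),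
      PStr.leg c k _ b' = b := by
  induction t with
  | var i =>
    refine ⟨j, 𝟙 j, PStr.trans D (𝟙 j) _ (m i), Part.mem_some _, ?_⟩
    rw [PStr.leg_trans]
    exact ((Part.mem_some_iff).mp hb).symm
  | app f t ih =>
    obtain ⟨a, ha, hb⟩ := (Term.mem_eval_app _ _ _ _ _).mp hb
    obtain ⟨k, u, hu⟩ := exists_common_stage (j := j) (hasCardinalLT_Iio _)
      (fun i k u => ∃ b' ∈ (t i).eval (D.obj k) (fun i => PStr.trans D u _ (m i)),
        PStr.leg c k _ b' = a i) (by
        rintro i k l u v ⟨b', hb', e⟩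
        refine ⟨PStr.trans D v _ b', ?_, by rw [PStr.leg_trans, e]⟩
        simp only [PStr.trans_comp]
        exact Term.map_eval (D.map v) _ (t i) b' hb') fun i => ih i (a i) (ha i)
    choose a' ha' e using hu
    obtain rfl : (fun i => PStr.leg c k _ (a' i)) = a := funext e
    obtain ⟨l, v, b', hb', e'⟩ := hc.func f k a' b hb
    refine ⟨l, u ≫ v, b', (Term.mem_eval_app _ _ _ _ _).mpr ⟨_, fun i => ?_, hb'⟩, e'⟩
    simp only [PStr.trans_comp]
    exact Term.map_eval (D.map v) _ (t i) _ (ha' i)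

lemma exists_holds (hc : IsConcreteColimit c) {x : Ctx κ S} {j : J}
    (m : ∀ i : x.Pos, (D.obj j).carrier (x.sort i)) (φ : Formula Sg x)
    (h : φ.Holds c.pt (fun i => PStr.leg c j _ (m i))) :
    ∃ (k : J) (u : j ⟶ k), φ.Holds (D.obj k) (fun i => PStr.trans D u _ (m i)) := by
  induction φ with
  | rel R t =>
    obtain ⟨a, hR, ha⟩ := h
    obtain ⟨k, u, hu⟩ := exists_common_stage (j := j) (hasCardinalLT_Iio _)
      (fun i k u => ∃ b' ∈ (t i).eval (D.obj k) (fun i => PStr.trans D u _ (m i)),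
        PStr.leg c k _ b' = a i) (by
        rintro i k l u v ⟨b', hb', e⟩
        refine ⟨PStr.trans D v _ b', ?_, by rw [PStr.leg_trans, e]⟩
        simp only [PStr.trans_comp]
        exact Term.map_eval (D.map v) _ (t i) b' hb')
      fun i => hc.exists_mem_eval m (t i) (a i) (ha i)
    choose a' ha' e using hu
    obtain rfl : (fun i => PStr.leg c k _ (a' i)) = a := funext e
    obtain ⟨l, v, hR'⟩ := hc.rel R k a' hR
    refine ⟨l, u ≫ v, _, hR', fun i => ?_⟩
    simp only [PStr.trans_comp]
    exact Term.map_eval (D.map v) _ (t i) _ (ha' i)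
  | eq t t' =>
    obtain ⟨a, ha, ha'⟩ := h
    obtain ⟨k, u, b, hb, e⟩ := hc.exists_mem_eval m t a ha
    obtain ⟨k', u', b', hb', e'⟩ := hc.exists_mem_eval m t' a ha'
    have := isFiltered_of_isCardinalFiltered J κ
    obtain ⟨l, p, p', hp⟩ := IsFiltered.span u u'
    obtain ⟨n, q, hq⟩ := hc.inj l _ (PStr.trans D p _ b) (PStr.trans D p' _ b')
      (by rw [PStr.leg_trans, PStr.leg_trans, e, e'])
    have h₁ := Term.map_eval (D.map q) _ t _ (Term.map_eval (D.map p) _ t b hb)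
    have h₂ := Term.map_eval (D.map q) _ t' _ (Term.map_eval (D.map p') _ t' b' hb')
    refine ⟨n, (u ≫ p) ≫ q, PStr.trans D q _ (PStr.trans D p _ b), ?_, ?_⟩
    · simpa only [PStr.trans_comp] using h₁
    · rw [hp, hq]
      simpa only [PStr.trans_comp] using h₂
  | conj α φ ih =>
    refine exists_common_stage (j := j) (hasCardinalLT_Iio _)
      (fun i k u => (φ i).Holds (D.obj k) (fun i => PStr.trans D u _ (m i))) ?_ fun i => ih i (h i)
    intro i k l u v h
    simp only [PStr.trans_comp]
    exact Formula.map_holds (D.map v) _ _ h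

lemma isModel (hc : IsConcreteColimit c) {T : Theory Sg} (hD : ∀ j, T.IsModel (D.obj j)) :
    T.IsModel c.pt := fun q hq m hm => by
  obtain ⟨j, a, ha⟩ := hc.exists_family (hasCardinalLT_Iio _) m
  obtain rfl := funext ha
  obtain ⟨k, u, hu⟩ := hc.exists_holds a q.hyp hm
  have := Formula.map_holds (c.ι.app k) _ _ (hD k q hq _ hu)
  simp only [PStr.leg_trans] at this
  exact this

end IsConcreteColimit

/-- The functor that takes a partial structure to its carrier of sort `s`. -/
def PStr.carrierFunctor (Sg : Signature κ S) (s : S) : PStr Sg ⥤ Type u where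
  obj M := M.carrier s
  map h := ↾(PStr.Hom.map h s)

lemma PStr.exists_isConcreteColimit (D : J ⥤ PStr Sg) : ∃ c : Cocone D, IsConcreteColimit c := by
  have := isFiltered_of_isCardinalFiltered J κ
  let K : S → Type u := fun s => colimit (D ⋙ PStr.carrierFunctor Sg s)
  let ι : ∀ j s, (D.obj j).carrier s → K s := fun j s =>
    colimit.ι (D ⋙ PStr.carrierFunctor Sg s) j
  have hι : ∀ {j k} (u : j ⟶ k) s a, ι k s (PStr.trans D u s a) = ι j s a := fun u s a =>
    ConcreteCategory.congr_hom (colimit.w (D ⋙ PStr.carrierFunctor Sg s) u) a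
  have hinj : ∀ j s a a', ι j s a = ι j s a' →
      ∃ (k : J) (u : j ⟶ k), PStr.trans D u s a = PStr.trans D u s a' := fun j s a a' h =>
    (Types.FilteredColimit.isColimit_eq_iff' (colimit.isColimit _) _ _).mp h
  have hsurj : ∀ s (b : K s), ∃ j a, ι j s a = b := fun s b =>
    Types.jointly_surjective_of_isColimit (colimit.isColimit _) b
  let N : PStr Sg :=
    { carrier := K
      func := fun f b => ⟨∃ j a c, c ∈ (D.obj j).func f a ∧ (fun i => ι j _ (a i)) = b,
        fun h => ι h.choose _ h.choose_spec.choose_spec.choose⟩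
      rel := fun R => {b | ∃ j, ∃ a ∈ (D.obj j).rel R, (fun i => ι j _ (a i)) = b} }
  have hfunc : ∀ f b c, c ∈ N.func f b ↔ ∃ j a c', c' ∈ (D.obj j).func f a ∧
      (fun i => ι j _ (a i)) = b ∧ ι j _ c' = c := by
    intro f b c
    constructor
    · rintro ⟨h, rfl⟩
      exact ⟨_, _, _, h.choose_spec.choose_spec.choose_spec.1,
        h.choose_spec.choose_spec.choose_spec.2, rfl⟩
    · rintro ⟨j, a, c', hc', ha, rfl⟩
      refine ⟨⟨j, a, c', hc', ha⟩, ?_⟩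
      have h : ∃ j a c, c ∈ (D.obj j).func f a ∧ (fun i => ι j _ (a i)) = b := ⟨j, a, c', hc', ha⟩
      obtain ⟨l, u, v, huv⟩ := PStr.exists_trans_eq ι hι hinj (hasCardinalLT_Iio _)
        h.choose_spec.choose a
        (congrFun (h.choose_spec.choose_spec.choose_spec.2.trans ha.symm))
      have h₁ := PStr.Hom.map_func (D.map u) f _ _ h.choose_spec.choose_spec.choose_spec.1
      have h₂ := PStr.Hom.map_func (D.map v) f _ _ hc'
      change _ ∈ (D.obj l).func f (fun i => PStr.trans D u _ _) at h₁
      rw [funext huv] at h₁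
      change ι _ _ h.choose_spec.choose_spec.choose = _
      rw [← hι u, ← hι v]
      exact congrArg _ (Part.mem_unique h₁ h₂)
  let c : Cocone D :=
    { pt := N
      ι :=
        { app := fun j => PStr.Hom.mk (N := N) (ι j)
            (fun f a b hb => (hfunc _ _ _).mpr ⟨j, a, b, hb, rfl, rfl⟩)
            (fun R a ha => ⟨j, a, ha, rfl⟩)
          naturality := fun j k u => PStr.Hom.ext (funext fun s => funext fun a => hι u s a) } }
  refine ⟨c, hsurj, hinj, fun f j a b hb => ?_, fun R j a h => ?_⟩
  · obtain ⟨k, a', b', hb', e, rfl⟩ := (hfunc _ _ _).mp hb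
    obtain ⟨l, u, v, huv⟩ := PStr.exists_trans_eq ι hι hinj (hasCardinalLT_Iio _) a a'
      (congrFun e.symm)
    refine ⟨l, u, PStr.trans D v _ b', ?_, hι v _ _⟩
    rw [funext huv]
    exact PStr.Hom.map_func (D.map v) f _ _ hb'
  · obtain ⟨k, a', h', e⟩ := h
    obtain ⟨l, u, v, huv⟩ := PStr.exists_trans_eq ι hι hinj (hasCardinalLT_Iio _) a a'
      (congrFun e.symm)
    refine ⟨l, u, ?_⟩
    rw [funext huv]
    exact PStr.Hom.map_rel (D.map v) R _ h'

variable {T : Theory Sg}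

lemma IsConcreteColimit.exists_isColimit {D : J ⥤ PMod T} {c : Cocone D}
    (hc : IsConcreteColimit ((Theory.IsModel T).ι.mapCocone c)) : Nonempty (IsColimit c) := by
  choose j a ha using hc.surj
  let c' := (Theory.IsModel T).ι.mapCocone c
  have hs : ∀ (s : Cocone D) {j k : J} (u : j ⟶ k) {t : S} (a : (D.obj j).obj.carrier t),
      (s.ι.app k).hom.map t (PStr.trans (D ⋙ (Theory.IsModel T).ι) u t a) =
        (s.ι.app j).hom.map t a :=
    fun s _ _ u _ a => PStr.leg_trans ((Theory.IsModel T).ι.mapCocone s) u a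
  have key : ∀ (s : Cocone D) {j k : J} {t : S} (a : (D.obj j).obj.carrier t)
      (a' : (D.obj k).obj.carrier t), PStr.leg c' j t a = PStr.leg c' k t a' →
      (s.ι.app j).hom.map t a = (s.ι.app k).hom.map t a' := by
    intro s j k t a a' h
    obtain ⟨l, u, v, huv⟩ := hc.exists_trans_eq (I := PUnit)
      (hasCardinalLT_of_finite _ _ (Fact.out : κ.IsRegular).aleph0_le)
      (s := fun _ => _) (fun _ => a) (fun _ => a') fun _ => h
    exact (hs s u a).symm.trans ((congrArg _ (huv ⟨⟩)).trans (hs s v a'))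
  have key' : ∀ (s : Cocone D) {k : J} {t : S} (a' : (D.obj k).obj.carrier t),
      (s.ι.app _).hom.map t (a t (PStr.leg c' k t a')) = (s.ι.app k).hom.map t a' :=
    fun s _ _ _ => key s _ _ (ha _ _)
  refine ⟨⟨fun s => ObjectProperty.homMk
    ⟨fun t b => (s.ι.app _).hom.map t (a t b), fun f b d hd => ?_, fun R b hb => ?_⟩,
    fun s k => PMod.hom_ext fun t b => key' s b, fun s m hm => PMod.hom_ext fun t b => ?_⟩⟩
  · obtain ⟨k, b, rfl⟩ : ∃ (k : J) (b' : ∀ i, (D.obj k).obj.carrier ((Sg.funArity f).sort i)),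
        (fun i => PStr.leg c' k _ (b' i)) = b := by
      obtain ⟨k, b', e⟩ := hc.exists_family (hasCardinalLT_Iio _) b
      exact ⟨k, b', funext e⟩
    obtain ⟨l, u, d, hd', rfl⟩ := hc.func f k b d hd
    have := PStr.Hom.map_func (s.ι.app l).hom f _ _ hd'
    rw [key']
    simp only [key', ← hs s u]
    exact this
  · obtain ⟨k, b, rfl⟩ : ∃ (k : J) (b' : ∀ i, (D.obj k).obj.carrier ((Sg.relArity R).sort i)),
        (fun i => PStr.leg c' k _ (b' i)) = b := by
      obtain ⟨k, b', e⟩ := hc.exists_family (hasCardinalLT_Iio _) b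
      exact ⟨k, b', funext e⟩
    obtain ⟨l, u, hd⟩ := hc.rel R k b hb
    have := PStr.Hom.map_rel (s.ι.app l).hom R _ hd
    simp only [key', ← hs s u]
    exact this
  · obtain ⟨k, b, rfl⟩ := hc.surj t b
    exact (PMod.congr_map (hm k) b).trans (key' s b).symm

lemma PMod.exists_isConcreteColimit (D : J ⥤ PMod T) :
    ∃ c : Cocone D, IsConcreteColimit ((Theory.IsModel T).ι.mapCocone c) := by
  obtain ⟨c, hc⟩ := PStr.exists_isConcreteColimit (D ⋙ (Theory.IsModel T).ι)
  exact ⟨⟨⟨c.pt, hc.isModel fun j => (D.obj j).property⟩,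
    { app := fun j => ObjectProperty.homMk (c.ι.app j)
      naturality := fun j k u => ObjectProperty.hom_ext _ (c.ι.naturality u) }⟩, hc⟩

lemma PMod.isConcreteColimit_of_isColimit {D : J ⥤ PMod T} {c : Cocone D} (hc : IsColimit c) :
    IsConcreteColimit ((Theory.IsModel T).ι.mapCocone c) := by
  obtain ⟨c', h⟩ := PMod.exists_isConcreteColimit D
  obtain ⟨hc'⟩ := h.exists_isColimit
  exact h.of_iso ((Cocone.functoriality D (Theory.IsModel T).ι).mapIso (hc'.uniqueUpToIso hc))

instance PMod.hasColimitsOfShape : HasColimitsOfShape J (PMod T) where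
  has_colimit D := by
    obtain ⟨c, hc⟩ := PMod.exists_isConcreteColimit D
    exact ⟨_, hc.exists_isColimit.some⟩

variable {S' : Type u} {Sg' : Signature κ S'} {T' : Theory Sg'}

/-- Translation functors preserve `κ`-filtered colimits. -/
lemma TheoryMorphism.preservesColimitsOfShape_U (ρ : TheoryMorphism T T') :
    PreservesColimitsOfShape J ρ.U where
  preservesColimit {D} := ⟨fun {c} hc => by
    have h := PMod.isConcreteColimit_of_isColimit hc
    refine IsConcreteColimit.exists_isColimit ⟨fun s b => h.surj _ b, fun j s => h.inj j _,
      fun f j a b hb => ?_, fun R j a hb => ?_⟩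
    · exact h.exists_mem_eval (x := (Sg.funArity f).map ρ.onSort) a (ρ.onFun f) b hb
    · exact h.exists_holds (x := (Sg.relArity R).map ρ.onSort) a (ρ.onRel R) hb⟩

end FilteredColimits

section Adjunction

variable {κ : Cardinal.{u}} [Fact κ.IsRegular] {S S' : Type u} {Sg : Signature κ S}
  {Sg' : Signature κ S'} {T : Theory Sg} {T' : Theory Sg'}

/-- Translation functors have left adjoints. -/
theorem TheoryMorphism.isRightAdjoint_U (ρ : TheoryMorphism T T') : ρ.U.IsRightAdjoint := by
  rw [isRightAdjoint_iff_hasInitial_structuredArrow]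
  intro Γ
  let Cnd : ∀ A : PMod T', (∀ x : Σ s, Γ.obj.carrier s, A.obj.carrier (ρ.onSort x.1)) → Prop :=
    fun A g => (∀ (f : Sg.Fun) a b, b ∈ Γ.obj.func f a →
        g ⟨_, b⟩ ∈ (ρ.onFun f).eval A.obj (fun i => g ⟨_, a i⟩)) ∧
      ∀ (R : Sg.Rel) a, a ∈ Γ.obj.rel R → (ρ.onRel R).Holds A.obj (fun i => g ⟨_, a i⟩)
  obtain ⟨N, n, hN⟩ := exists_isUniversal_top T' (fun x : Σ s, Γ.obj.carrier s => ρ.onSort x.1) Cnd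
  let η : Γ ⟶ ρ.U.obj N := ObjectProperty.homMk (PStr.Hom.mk (N := (ρ.U.obj N).obj)
    (fun s a => n ⟨s, a⟩)
    (fun f a b hb => hN.jointlyClosed.mem_eval (x := (Sg.funArity f).map ρ.onSort)
      (fun i => n ⟨_, a i⟩) (ρ.onFun f) (n ⟨_, b⟩) fun p => p.2.2.1 f a b hb)
    (fun R a ha => hN.holds (x := (Sg.relArity R).map ρ.onSort) (ρ.onRel R)
      (fun i => n ⟨_, a i⟩) fun A h _ hA => hA.2 R a ha))
  refine IsInitial.hasInitial (X := StructuredArrow.mk η) (IsInitial.ofUniqueHom (fun X => ?_) ?_)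
  · have h := hN.exists_hom X.right (fun x => X.hom.hom.map x.1 x.2) trivial
      ⟨X.hom.hom.map_func, X.hom.hom.map_rel⟩
    exact StructuredArrow.homMk h.choose
      (PMod.hom_ext fun s a => congrFun h.choose_spec ⟨s, a⟩)
  · intro X m
    refine StructuredArrow.hom_ext _ _ (hN.hom_ext fun x => ?_)
    have h := hN.exists_hom X.right (fun x => X.hom.hom.map x.1 x.2) trivial
      ⟨X.hom.hom.map_func, X.hom.hom.map_rel⟩
    exact (PMod.congr_map (StructuredArrow.w m) x.2).trans (congrFun h.choose_spec x).symm

/-- Models presented by a Horn formula are `κ`-presentable. -/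
lemma IsUniversal.isCardinalPresentable {x : Ctx κ S} {φ : Formula Sg x} {N : PMod T} {n}
    (hN : IsUniversal ⊤ x.sort (fun A a => φ.Holds A.obj a) N n) : IsCardinalPresentable N κ where
  preservesColimitOfShape J _ _ := ⟨fun {D} => ⟨fun {c} hc => by
    have h := PMod.isConcreteColimit_of_isColimit hc
    refine ⟨Types.FilteredColimit.isColimitOf _ _ (fun (f : N ⟶ c.pt) => ?_)
      fun j k (f : N ⟶ D.obj j) (g : N ⟶ D.obj k) (e : f ≫ c.ι.app j = g ≫ c.ι.app k) => ?_⟩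
    · obtain ⟨j, a, ha⟩ := h.exists_family (hasCardinalLT_Iio _) (fun i => f.hom.map _ (n i))
      have hφ := Formula.map_holds f.hom _ φ hN.holds_generic
      rw [← funext ha] at hφ
      obtain ⟨k, u, hu⟩ := h.exists_holds a φ hφ
      obtain ⟨g, hg⟩ := hN.exists_hom (D.obj k) _ trivial hu
      refine ⟨k, g, hN.hom_ext fun i => ?_⟩
      rw [← ha]
      refine (PStr.leg_trans _ u _).symm.trans ?_
      exact congrArg _ (congrFun hg i).symm
    · obtain ⟨l, u, v, huv⟩ := h.exists_trans_eq (hasCardinalLT_Iio _)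
        (fun i => f.hom.map _ (n i)) (fun i => g.hom.map _ (n i))
        fun i => PMod.congr_map e (n i)
      exact ⟨l, u, v, hN.hom_ext huv⟩⟩⟩

/-- Validity of a relative judgment is orthogonality to a dense morphism. -/
lemma TheoryMorphism.exists_isDense_orthogonal_iff_valid (ρ : TheoryMorphism T T')
    {F : PMod T ⥤ PMod T'} (adj : F ⊣ ρ.U) (x : Ctx κ S) (φ : Formula Sg x)
    (ψ : Formula Sg' (x.map ρ.onSort)) :
    ∃ (Γ : PMod T) (Δ : PMod T') (e : F.obj Γ ⟶ Δ), IsCardinalPresentable Γ κ ∧ IsDense e ∧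
      ∀ M : PMod T', Function.Bijective (fun g : Δ ⟶ M => e ≫ g) ↔
        Sequent.Valid ⟨x.map ρ.onSort, ρ.formula φ, ψ⟩ M.obj := by
  obtain ⟨Γ, n, hΓ⟩ := exists_isUniversal_top T x.sort fun A a => φ.Holds A.obj a
  obtain ⟨Δ, d, hΔ⟩ := exists_isUniversal_top T' (x.map ρ.onSort).sort
    fun A a => ((ρ.formula φ).and ψ).Holds A.obj a
  have hd := (Formula.and_holds _ _ _ _).mp hΔ.holds_generic
  have hom : ∀ (M : PMod T') (m), (ρ.formula φ).Holds M.obj m →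
      ∃ k : Γ ⟶ ρ.U.obj M, (fun i => k.hom.map _ (n i)) = m := fun M m hm =>
    hΓ.exists_hom (ρ.U.obj M) m trivial ((ρ.holds_pullback M.obj m φ).mpr hm)
  obtain ⟨k, hk⟩ := hom Δ d hd.1
  let e := (adj.homEquiv _ _).symm k
  have he : ∀ {M : PMod T'} (g : Δ ⟶ M) (g' : F.obj Γ ⟶ M), e ≫ g = g' ↔
      ∀ i, g.hom.map _ (d i) = (adj.homEquiv _ _ g').hom.map _ (n i) := by
    intro M g g'
    rw [← (adj.homEquiv _ _).injective.eq_iff, adj.homEquiv_naturality_right,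
      Equiv.apply_symm_apply, ← hk]
    exact ⟨fun h i => PMod.congr_map h (n i), fun h => hΓ.hom_ext h⟩
  refine ⟨Γ, Δ, e, hΓ.isCardinalPresentable, fun C m hm ⟨g, hg⟩ => ?_, fun M => ⟨fun h m hm => ?_,
    fun h => ⟨fun g g' hgg => hΔ.hom_ext fun i => ?_, fun g => ?_⟩⟩⟩
  · let c := fun i => (adj.homEquiv _ _ g).hom.map _ (n i)
    have hc : ∀ i, m.hom.map _ (c i) = d i := fun i => by
      have h₁ := PMod.congr_map (adj.homEquiv_naturality_right g m) (n i)
      have h₂ := (he (𝟙 Δ) (g ≫ m)).mp (by rw [hg, Category.comp_id]) i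
      exact h₁.symm.trans h₂.symm
    obtain ⟨l, hl⟩ := hΔ.exists_hom C c trivial (hm.holds _ _ (by
      simp only [hc]
      exact hΔ.holds_generic))
    have := hm.mono
    have hlm : l ≫ m = 𝟙 Δ := hΔ.hom_ext fun i =>
      (congrArg (m.hom.map _) (congrFun hl i)).trans (hc i)
    have : IsSplitEpi m := ⟨⟨l, hlm⟩⟩
    exact isIso_of_mono_of_isSplitEpi m
  · obtain ⟨k', hk'⟩ := hom M m hm
    obtain ⟨g, hg⟩ := h.2 ((adj.homEquiv _ _).symm k')
    have hg := (he _ _).mp hg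
    rw [Equiv.apply_symm_apply] at hg
    rw [← hk', ← funext hg]
    exact Formula.map_holds g.hom _ ψ hd.2
  · have := (he g _).mp hgg i
    exact this.trans ((he g' _).mp rfl i).symm
  · let m := fun i => (adj.homEquiv _ _ g).hom.map _ (n i)
    have hm : (ρ.formula φ).Holds (x := x.map ρ.onSort) M.obj m :=
      (ρ.holds_pullback M.obj m φ).mp (Formula.map_holds (adj.homEquiv _ _ g).hom _ φ
        hΓ.holds_generic)
    obtain ⟨g', hg'⟩ := hΔ.exists_hom M m trivial ((Formula.and_holds _ _ _ _).mpr ⟨hm, h m hm⟩)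
    exact ⟨g', (he _ _).mpr (congrFun hg')⟩

lemma IsDense.bijective_of_isSplitEpi {ρ : TheoryMorphism T T'} {F : PMod T ⥤ PMod T'}
    (adj : F ⊣ ρ.U) {Γ : PMod T} {Δ M N : PMod T'} {e : F.obj Γ ⟶ Δ} (he : IsDense e) (p : M ⟶ N)
    [IsSplitEpi (ρ.U.map p)]
    (hM : Function.Bijective (fun g : Δ ⟶ M => e ≫ g)) :
    Function.Bijective (fun g : Δ ⟶ N => e ≫ g) := by
  refine he.bijective_of_exists fun g => ?_
  obtain ⟨g', hg'⟩ := hM.2 ((adj.homEquiv _ _).symm (adj.homEquiv _ _ g ≫ section_ (ρ.U.map p)))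
  refine ⟨g' ≫ p, ?_⟩
  simp only at hg'
  rw [reassoc_of% hg', ← adj.homEquiv_naturality_right_symm]
  simp

lemma IsDense.bijective_of_isColimit {ρ : TheoryMorphism T T'} {F : PMod T ⥤ PMod T'}
    (adj : F ⊣ ρ.U) {Γ : PMod T} {Δ : PMod T'} {e : F.obj Γ ⟶ Δ} [IsCardinalPresentable Γ κ]
    (he : IsDense e) {J : Type u} [SmallCategory J] [IsCardinalFiltered J κ]
    {D : J ⥤ PMod T'} {c : Cocone D} (hc : IsColimit c)
    (hD : ∀ j, Function.Bijective (fun g : Δ ⟶ D.obj j => e ≫ g)) :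
    Function.Bijective (fun g : Δ ⟶ c.pt => e ≫ g) := by
  refine he.bijective_of_exists fun g => ?_
  have := ρ.preservesColimitsOfShape_U (J := J)
  obtain ⟨j, k, hk⟩ := IsCardinalPresentable.exists_hom_of_isColimit κ
    (isColimitOfPreserves ρ.U hc) (adj.homEquiv _ _ g)
  obtain ⟨g', hg'⟩ := (hD j).2 ((adj.homEquiv _ _).symm k)
  refine ⟨g' ≫ c.ι.app j, ?_⟩
  simp only at hg'
  rw [reassoc_of% hg', ← adj.homEquiv_naturality_right_symm]
  exact ((adj.homEquiv _ _).symm_apply_eq).mpr hk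

end Adjunction

section SmallContexts

variable {κ : Cardinal.{u}} {S : Type u} {Sg : Signature κ S}

lemma exists_Iio_equiv {ι : Type u} (hι : HasCardinalLT ι κ) :
    ∃ α : κ.ord.ToType, Nonempty (Set.Iio α ≃ ι) := by
  rw [hasCardinalLT_iff_cardinal_mk_lt] at hι
  let o : Set.Iio κ.ord := ⟨_, Cardinal.ord_lt_ord.mpr hι⟩
  have h := congrArg Subtype.val (Ordinal.ToType.mk.symm_apply_apply o)
  exact ⟨Ordinal.ToType.mk o, Cardinal.eq.mp ((Ordinal.card_typein
    (α := κ.ord.ToType) (r := (· < ·)) _).trans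
    ((congrArg Ordinal.card h).trans (Cardinal.card_ord (Cardinal.mk ι))))⟩

/-- In a context indexed by `ι`, every element of `ι` is represented by a variable. -/
lemma Term.exists_eval_eq {ι : Type u} {α : κ.ord.ToType} (e : Set.Iio α ≃ ι) (sort : ι → S)
    (i : ι) : ∃ t : Term Sg ⟨α, fun p => sort (e p)⟩ (sort i),
      ∀ (A : PStr Sg) (w : ∀ i, A.carrier (sort i)), w i ∈ t.eval A (fun p => w (e p)) := by
  obtain ⟨p, rfl⟩ := e.surjective i
  exact ⟨.var (x := ⟨α, fun p => sort (e p)⟩) p, fun A w => Part.mem_some _⟩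

lemma PStr.exists_hom_of_holds {x : Ctx κ S} {N M : PStr Sg} {n : ∀ i : x.Pos, N.carrier (x.sort i)}
    {m : ∀ i : x.Pos, M.carrier (x.sort i)}
    (gen : ∀ s (c : N.carrier s), ∃ t : Term Sg x s, c ∈ t.eval N n)
    (h : ∀ ψ : Formula Sg x, ψ.Holds N n → ψ.Holds M m) :
    ∃ k : N ⟶ M, ∀ i, PStr.Hom.map k _ (n i) = m i := by
  choose t ht using gen
  have h' : ∀ s c, ∃ a, a ∈ (t s c).eval M m := fun s c =>
    (Term.defined_holds M m _).mp (h _ ((Term.defined_holds N n _).mpr ⟨c, ht s c⟩))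
  choose k hk using h'
  have key : ∀ {s} (c : N.carrier s) (t' : Term Sg x s), c ∈ t'.eval N n →
      k s c ∈ t'.eval M m := fun c t' hc => by
    obtain ⟨a, ha, ha'⟩ := h (.eq (t _ c) t') ⟨c, ht _ c, hc⟩
    rwa [Part.mem_unique (hk _ c) ha]
  refine ⟨PStr.Hom.mk k (fun f a b hb => ?_) fun R a ha => ?_, fun i => ?_⟩
  · obtain ⟨a', ha', hb'⟩ := (Term.mem_eval_app _ _ _ _ _).mp (key b (.app f fun i => t _ (a i))
      ((Term.mem_eval_app _ _ _ _ _).mpr ⟨a, fun i => ht _ _, hb⟩))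
    rwa [show (fun j => k _ (a j)) = a' from funext fun i => Part.mem_unique (hk _ _) (ha' i)]
  · obtain ⟨a', hR, ha'⟩ := h (.rel R fun i => t _ (a i)) ⟨a, ha, fun i => ht _ _⟩
    rwa [show (fun j => k _ (a j)) = a' from funext fun i => Part.mem_unique (hk _ _) (ha' i)]
  · exact Part.mem_some_iff.mp (key (n i) (.var i) (Part.mem_some _))

end SmallContexts

section Facts

variable {κ : Cardinal.{u}} {S S' : Type u} {Sg : Signature κ S} {Sg' : Signature κ S'}

/-- A Horn formula together with a tuple of elements of `L` that satisfies it. -/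
structure HornFact (L : PStr Sg) : Type u where
  ctx : Ctx κ S
  formula : Formula Sg ctx
  val : ∀ i : ctx.Pos, L.carrier (ctx.sort i)
  holds : formula.Holds L val

namespace HornFact

variable {L : PStr Sg}

/-- The elements that a fact is about. -/
abbrev elt (q : HornFact L) (i : q.ctx.Pos) : Σ s, L.carrier s := ⟨q.ctx.sort i, q.val i⟩

/-- The elements that occur in a set of facts. -/
def supp (Q : Set (HornFact L)) : Set (Σ s, L.carrier s) := {x | ∃ q ∈ Q, ∃ i, q.elt i = x}

lemma elt_mem_supp {Q : Set (HornFact L)} {q : HornFact L} (hq : q ∈ Q) (i : q.ctx.Pos) :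
    q.elt i ∈ supp Q := ⟨q, hq, i, rfl⟩

lemma supp_mono {Q Q' : Set (HornFact L)} (h : Q ⊆ Q') : supp Q ⊆ supp Q' :=
  fun _ ⟨q, hq, hx⟩ => ⟨q, h hq, hx⟩

/-- An assignment of elements of `A` to the elements occurring in `Q` satisfies the facts in `Q`,
read via the translation `ρ`. -/
def Sat (ρ : Translation Sg Sg') (Q : Set (HornFact L)) (A : PStr Sg')
    (g : ∀ x : supp Q, A.carrier (ρ.onSort x.1.1)) : Prop :=
  ∀ q (hq : q ∈ Q), q.formula.Holds (ρ.pullback A) (fun i => g ⟨q.elt i, elt_mem_supp hq i⟩)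

lemma exists_rel (ρ : Translation Sg Sg') (R : Sg.Rel)
    (a : ∀ i, L.carrier ((Sg.relArity R).sort i)) (hR : a ∈ L.rel R) :
    ∃ (q : HornFact L) (ha : ∀ i, ⟨_, a i⟩ ∈ supp {q}),
      ∀ (A : PStr Sg') (g : ∀ x : supp {q}, (ρ.pullback A).carrier x.1.1), Sat ρ {q} A g →
        (fun i => g ⟨⟨_, a i⟩, ha i⟩ : ∀ i, (ρ.pullback A).carrier ((Sg.relArity R).sort i)) ∈
          (ρ.pullback A).rel R := by
  refine ⟨⟨Sg.relArity R, .rel R .var, a, a, hR, fun i => Part.mem_some _⟩,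
    fun i => ⟨_, rfl, i, rfl⟩, fun A g hg => ?_⟩
  obtain ⟨a', ha, ha'⟩ := hg _ rfl
  obtain rfl := funext fun i => Part.mem_some_iff.mp (ha' i)
  exact ha

variable [Fact κ.IsRegular]

lemma hasCardinalLT_supp {Q : Set (HornFact L)} (hQ : HasCardinalLT Q κ) :
    HasCardinalLT (supp Q) κ :=
  (hasCardinalLT_sigma (fun q : Q => q.1.ctx.Pos) κ hQ fun q => hasCardinalLT_Iio _).of_surjective
    (fun p => ⟨p.1.1.elt p.2, elt_mem_supp p.1.2 p.2⟩) (by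
      rintro ⟨_, q, hq, i, rfl⟩
      exact ⟨⟨⟨q, hq⟩, i⟩, rfl⟩)

lemma exists_mem_supp (x : Σ s, L.carrier s) : ∃ q : HornFact L, x ∈ supp {q} := by
  obtain ⟨α, ⟨e⟩⟩ := exists_Iio_equiv (κ := κ) (ι := PUnit.{u + 1})
    (hasCardinalLT_of_finite _ _ (Fact.out : κ.IsRegular).aleph0_le)
  exact ⟨⟨⟨α, fun _ => x.1⟩, .truth, fun _ => x.2, fun i => absurd i.2 (not_lt_natIdx_zero _)⟩,
    _, rfl, e.symm ⟨⟩, rfl⟩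

lemma exists_func (ρ : Translation Sg Sg') (f : Sg.Fun)
    (a : ∀ i, L.carrier ((Sg.funArity f).sort i)) (b) (hb : b ∈ L.func f a) :
    ∃ (q : HornFact L) (ha : ∀ i, ⟨_, a i⟩ ∈ supp {q}) (hb : ⟨_, b⟩ ∈ supp {q}),
      ∀ (A : PStr Sg') (g : ∀ x : supp {q}, (ρ.pullback A).carrier x.1.1), Sat ρ {q} A g →
        (g ⟨⟨_, b⟩, hb⟩ : (ρ.pullback A).carrier _) ∈
          (ρ.pullback A).func f (fun i => g ⟨⟨_, a i⟩, ha i⟩) := by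
  obtain ⟨α, ⟨e⟩⟩ := exists_Iio_equiv (κ := κ) (ι := Option (Sg.funArity f).Pos)
    ((hasCardinalLT_option_iff _ _ (Fact.out : κ.IsRegular).aleph0_le).mpr (hasCardinalLT_Iio _))
  let el : Option (Sg.funArity f).Pos → Σ s, L.carrier s := fun o =>
    o.elim ⟨_, b⟩ fun i => ⟨_, a i⟩
  choose t ht using Term.exists_eval_eq (Sg := Sg) e (fun o => (el o).1)
  let q : HornFact L :=
    { ctx := ⟨α, fun p => (el (e p)).1⟩
      formula := .eq (.app f fun i => t (some i)) (t none)
      val := fun p => (el (e p)).2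
      holds := ⟨b, (Term.mem_eval_app _ _ _ _ _).mpr
        ⟨a, fun i => ht (some i) L fun o => (el o).2, hb⟩, ht none L fun o => (el o).2⟩ }
  have hel : ∀ o, el o ∈ supp {q} := fun o => ⟨q, rfl, e.symm o, by
    change el (e (e.symm o)) = el o
    rw [e.apply_symm_apply]⟩
  refine ⟨q, fun i => hel (some i), hel none, fun A g hg => ?_⟩
  let w : ∀ o, (ρ.pullback A).carrier (el o).1 := fun o => g ⟨el o, hel o⟩
  obtain ⟨c, hc, hc'⟩ := hg q rfl
  obtain ⟨a', ha', hc⟩ := (Term.mem_eval_app _ _ _ _ _).mp hc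
  have h₁ := Part.mem_unique hc' (ht none (ρ.pullback A) w)
  have h₂ : a' = fun i => w (some i) :=
    funext fun i => Part.mem_unique (ha' i) (ht (some i) (ρ.pullback A) w)
  rw [h₁, h₂] at hc
  exact hc

variable {T : Theory Sg} {T' : Theory Sg'}

/-- A `κ`-small set of facts is expressed by a single Horn formula. -/
lemma exists_formula (ρ : Translation Sg Sg') {Q : Set (HornFact L)} (hQ : HasCardinalLT Q κ)
    {α : κ.ord.ToType} (e : Set.Iio α ≃ supp Q) :
    ∃ φ : Formula Sg ⟨α, fun p => (e p).1.1⟩, ∀ (A : PStr Sg') (g),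
      (ρ.formula φ).Holds A (fun p => g (e p)) ↔ Sat ρ Q A g := by
  obtain ⟨β, ⟨e'⟩⟩ := exists_Iio_equiv hQ
  choose t ht using Term.exists_eval_eq (Sg := Sg) e (fun x => x.1.1)
  let φ : Formula Sg ⟨α, fun p => (e p).1.1⟩ := .conj β fun j => (e' j).1.formula.subst
    fun i => t ⟨(e' j).1.elt i, elt_mem_supp (e' j).2 i⟩
  refine ⟨φ, fun A g => ?_⟩
  have h : ∀ q : Q, (q.1.formula.subst fun i => t ⟨q.1.elt i, elt_mem_supp q.2 i⟩).Holds
      (ρ.pullback A) (fun p => g (e p)) ↔ q.1.formula.Holds (ρ.pullback A)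
        (fun i => g ⟨q.1.elt i, elt_mem_supp q.2 i⟩) := fun q =>
    Formula.subst_holds (ρ.pullback A) _ _ _ (fun i => ht _ (ρ.pullback A) g) _
  refine Iff.trans (ρ.holds_pullback A (x := ⟨α, fun p => (e p).1.1⟩) (fun p => g (e p)) φ).symm
    (Iff.intro (fun H q hq => ?_) fun (H : Sat ρ Q A g) j => (h (e' j)).mpr (H _ (e' j).2))
  obtain ⟨j, hj⟩ := e'.surjective ⟨q, hq⟩
  have := (h _).mp (H j)
  rw [hj] at this
  exact this

lemma sat_generic {ρ : Translation Sg Sg'} {Q : Set (HornFact L)} {E : ObjectProperty (PMod T')}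
    {N : PMod T'} {n} (hN : IsUniversal E (fun x : supp Q => ρ.onSort x.1.1)
      (fun A g => Sat ρ Q A.obj g) N n) : Sat ρ Q N.obj n := fun q hq =>
  (ρ.holds_pullback _ _ _).mpr (hN.holds (x := q.ctx.map ρ.onSort) _ _ fun A _ _ hA =>
    (ρ.holds_pullback A.obj _ _).mp (hA q hq))

/-- If all relative judgments that are valid in `E` are valid in `M`, then the universal model
in `E` that satisfies a `κ`-small part of the diagram of `U^ρ M` maps to `M`. -/
lemma exists_hom {ρ : TheoryMorphism T T'} {E : ObjectProperty (PMod T')} {M : PMod T'}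
    (hM : ∀ q, ρ.IsRelativeJudgment q → (∀ A : PMod T', E A → q.Valid A.obj) → q.Valid M.obj)
    {Q : Set (HornFact (ρ.U.obj M).obj)} (hQ : HasCardinalLT Q κ) {N : PMod T'} {n}
    (hN : IsUniversal E (fun x : supp Q => ρ.onSort x.1.1)
      (fun A g => Sat ρ.toTranslation Q A.obj g) N n) :
    ∃ p : N ⟶ M, ∀ x, p.hom.map _ (n x) = x.1.2 := by
  obtain ⟨α, ⟨e⟩⟩ := exists_Iio_equiv (hasCardinalLT_supp hQ)
  obtain ⟨φ, hφ⟩ := exists_formula ρ.toTranslation hQ e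
  let y : Ctx κ S' := ⟨α, fun p => ρ.onSort (e p).1.1⟩
  have gen : ∀ s (a : N.obj.carrier s), ∃ t : Term Sg' y s, a ∈ t.eval N.obj fun p => n (e p) := by
    refine hN.induction _ (fun x => ?_) fun f a b hb ih => ?_
    · obtain ⟨t, ht⟩ := Term.exists_eval_eq (Sg := Sg') e (fun x => ρ.onSort x.1.1) x
      exact ⟨t, ht N.obj n⟩
    · choose t ht using ih
      exact ⟨.app f t, (Term.mem_eval_app _ _ _ _ _).mpr ⟨a, ht, hb⟩⟩
  obtain ⟨p, hp⟩ := PStr.exists_hom_of_holds (x := y) (M := M.obj) (n := fun p => n (e p))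
    (m := fun p => ((e p).1.2 : M.obj.carrier (ρ.onSort (e p).1.1))) gen
    fun ψ hψ => by
      refine hM ⟨y, ρ.formula φ, ψ⟩ ⟨_, φ, ψ, rfl⟩ (fun A hA m hm => ?_) _
        ((hφ M.obj fun x => x.1.2).mpr fun q _ => q.holds)
      obtain ⟨w, rfl⟩ : ∃ w : ∀ x : supp Q, A.obj.carrier (ρ.onSort x.1.1),
          (fun p => w (e p)) = m :=
        ⟨Equiv.piCongrLeft (fun x : supp Q => A.obj.carrier (ρ.onSort x.1.1)) e m,
          funext fun p => Equiv.piCongrLeft_apply_apply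
            (fun x : supp Q => A.obj.carrier (ρ.onSort x.1.1)) e m p⟩
      obtain ⟨h, rfl⟩ := hN.exists_hom A w hA ((hφ A.obj w).mp hm)
      exact Formula.map_holds h.hom _ ψ hψ
  refine ⟨ObjectProperty.homMk p, fun x => ?_⟩
  obtain ⟨i, rfl⟩ := e.surjective x
  exact hp i

end HornFact

variable [Fact κ.IsRegular] {T : Theory Sg} {T' : Theory Sg'}

theorem TheoryMorphism.prop_of_valid (ρ : TheoryMorphism T T') (E : ObjectProperty (PMod T'))
    (hprod : ∀ J : Type u, E.IsClosedUnderLimitsOfShape (Discrete J))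
    (hsub : ∀ ⦃M N : PMod T'⦄ (m : M ⟶ N), IsClosedMono m → E N → E M)
    (hretract : ∀ ⦃M N : PMod T'⦄ (p : M ⟶ N), IsSplitEpi (ρ.U.map p) → E M → E N)
    (hcolim : ∀ (J : Type u) [SmallCategory J] [IsCardinalFiltered J κ],
      E.IsClosedUnderColimitsOfShape J) (M : PMod T')
    (hM : ∀ q, ρ.IsRelativeJudgment q → (∀ A : PMod T', E A → q.Valid A.obj) → q.Valid M.obj) :
    E M := by
  let L := (ρ.U.obj M).obj
  let P : Type u := {Q : Set (HornFact L) // HasCardinalLT Q κ}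
  have hP : IsCardinalFiltered P κ := isCardinalFiltered_preorder P κ fun K s hK => by
    refine ⟨⟨⋃ k, (s k).1, ?_⟩, fun k => Set.subset_iUnion (fun k => (s k).1) k⟩
    exact hasCardinalLT_iUnion _ ((hasCardinalLT_iff_cardinal_mk_lt _ _).mpr hK) fun k => (s k).2
  choose N n hN using fun Q : P => exists_isUniversal E hprod hsub
    (fun x : HornFact.supp Q.1 => ρ.onSort x.1.1)
    (fun A g => HornFact.Sat ρ.toTranslation Q.1 A.obj g)
  have htr : ∀ {Q Q' : P} (h : Q ≤ Q'), ∃ k : N Q ⟶ N Q',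
      (fun x : HornFact.supp Q.1 => k.hom.map _ (n Q x)) =
        fun x : HornFact.supp Q.1 => n Q' ⟨x.1, HornFact.supp_mono h x.2⟩ :=
    fun {Q Q'} h => (hN Q).exists_hom (N Q') _ (hN Q').prop fun q hq =>
      HornFact.sat_generic (hN Q') q (h hq)
  choose tr htr using @htr
  have htr' : ∀ {Q Q' : P} (h : Q ≤ Q') x, (tr h).hom.map _ (n Q x) =
      n Q' ⟨x.1, HornFact.supp_mono h x.2⟩ := fun h x => congrFun (htr h) x
  choose p hp using fun Q : P => HornFact.exists_hom hM Q.2 (hN Q)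
  let D : P ⥤ PMod T' :=
    { obj := N
      map := fun u => tr (leOfHom u)
      map_id := fun Q => (hN Q).hom_ext fun x => htr' _ x
      map_comp := fun {Q Q' Q''} u v => (hN Q).hom_ext fun x => by
        have h₁ := congrArg ((tr (leOfHom v)).hom.map _) (htr' (leOfHom u) x)
        exact (htr' (leOfHom (u ≫ v)) x).trans ((htr' (leOfHom v)
          ⟨x.1, HornFact.supp_mono (leOfHom u) x.2⟩).symm.trans h₁.symm) }
  let c := colimit.cocone D
  have hc : IsColimit c := colimit.isColimit D
  have hEc : E c.pt := E.prop_of_isColimit hc fun Q => (hN Q).prop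
  let s : Cocone D :=
    { pt := M
      ι :=
        { app := p
          naturality := fun Q Q' u => (hN Q).hom_ext fun x => by
            have h₁ := congrArg ((p Q').hom.map _) (htr' (leOfHom u) x)
            exact h₁.trans
              ((hp Q' ⟨x.1, HornFact.supp_mono (leOfHom u) x.2⟩).trans (hp Q x).symm) } }
  let γ : ∀ (Q : P) (x : HornFact.supp Q.1), c.pt.obj.carrier (ρ.onSort x.1.1) :=
    fun Q x => (c.ι.app Q).hom.map _ (n Q x)
  have hγ : ∀ {Q Q' : P} (h : Q ≤ Q') x, γ Q x = γ Q' ⟨x.1, HornFact.supp_mono h x.2⟩ :=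
    fun {Q Q'} h x => by
      have h₁ := congrArg ((c.ι.app Q').hom.map _) (htr' h x)
      exact (PMod.congr_map (c.w (homOfLE h)) (n Q x)).symm.trans h₁
  have hγ' : ∀ (Q Q' : P) (x : Σ s, L.carrier s) (hx hx'), γ Q ⟨x, hx⟩ = γ Q' ⟨x, hx'⟩ :=
    fun Q Q' x hx hx' => by
      have := isFiltered_of_isCardinalFiltered P κ
      rw [hγ (leOfHom (IsFiltered.leftToMax Q Q')), hγ (leOfHom (IsFiltered.rightToMax Q Q'))]
  have hsing : ∀ q : HornFact L, HasCardinalLT ({q} : Set (HornFact L)) κ := fun q =>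
    hasCardinalLT_of_finite _ _ (Fact.out : κ.IsRegular).aleph0_le
  choose q hq using fun x : Σ s, L.carrier s => HornFact.exists_mem_supp x
  have hsat : ∀ Q : P, HornFact.Sat ρ.toTranslation Q.1 c.pt.obj (γ Q) := fun Q q hq =>
    Formula.map_holds (ρ.U.map (c.ι.app Q)).hom _ _ (HornFact.sat_generic (hN Q) q hq)
  let σ : ρ.U.obj M ⟶ ρ.U.obj c.pt := ObjectProperty.homMk (PStr.Hom.mk (N := (ρ.U.obj c.pt).obj)
    (fun s a => γ ⟨_, hsing (q ⟨s, a⟩)⟩ ⟨⟨s, a⟩, hq _⟩)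
    (fun f a b hb => by
      obtain ⟨r, ha, hb', h⟩ := HornFact.exists_func ρ.toTranslation f a b hb
      have := h c.pt.obj _ (hsat ⟨{r}, hsing r⟩)
      rw [hγ' _ ⟨{r}, hsing r⟩ ⟨_, b⟩ _ hb']
      simp only [hγ' _ ⟨{r}, hsing r⟩ ⟨_, a _⟩ _ (ha _)]
      exact this)
    (fun R a hR => by
      obtain ⟨r, ha, h⟩ := HornFact.exists_rel ρ.toTranslation R a hR
      have := h c.pt.obj _ (hsat ⟨{r}, hsing r⟩)
      simp only [hγ' _ ⟨{r}, hsing r⟩ ⟨_, a _⟩ _ (ha _)]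
      exact this))
  refine hretract (hc.desc s) ⟨⟨⟨σ, PMod.hom_ext fun t a => ?_⟩⟩⟩ hEc
  exact (PMod.congr_map (hc.fac s _) _).trans (hp _ ⟨⟨t, a⟩, hq _⟩)

end Facts

end PHL

open CategoryTheory Limits in
theorem mainTheorem2 {κ : Cardinal.{u}} [Fact κ.IsRegular] {S S' : Type u}
    {Sg : PHL.Signature κ S} {Sg' : PHL.Signature κ S'}
    {𝕊 : PHL.Theory Sg} {𝕋 : PHL.Theory Sg'} (ρ : PHL.TheoryMorphism 𝕊 𝕋)
    (E : ObjectProperty (PHL.PMod 𝕋)) [E.IsClosedUnderIsomorphisms] :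
    ρ.U.IsRightAdjoint ∧
    ∀ (F : PHL.PMod 𝕊 ⥤ PHL.PMod 𝕋) (_ : F ⊣ ρ.U), List.TFAE [
      ∃ 𝕋' : PHL.Theory Sg', (∀ q ∈ 𝕋', ρ.IsRelativeJudgment q) ∧
        ∀ M : PHL.PMod 𝕋, E M ↔ PHL.Theory.IsModel (𝕋 ∪ 𝕋') M.obj,
      ∃ (I : Type u) (Γ : I → PHL.PMod 𝕊) (Δ : I → PHL.PMod 𝕋)
        (e : ∀ i, F.obj (Γ i) ⟶ Δ i),
        (∀ i, IsCardinalPresentable (Γ i) κ) ∧ (∀ i, PHL.IsDense (e i)) ∧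
        E = (MorphismProperty.ofHoms e).isLocal,
      (∀ J : Type u, E.IsClosedUnderLimitsOfShape (Discrete J)) ∧
        (∀ ⦃M N : PHL.PMod 𝕋⦄ (m : M ⟶ N), PHL.IsClosedMono m → E N → E M) ∧
        (∀ ⦃M N : PHL.PMod 𝕋⦄ (p : M ⟶ N), IsSplitEpi (ρ.U.map p) → E M → E N) ∧
        (∀ (J : Type u) [SmallCategory J] [IsCardinalFiltered J κ],
          E.IsClosedUnderColimitsOfShape J)] := by
  refine ⟨ρ.isRightAdjoint_U, fun F adj => ?_⟩
  tfae_have 1 → 2 := by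
    rintro ⟨𝕋', h𝕋', hE⟩
    choose x φ ψ hq using fun q : 𝕋' => h𝕋' q.1 q.2
    choose Γ Δ e hΓ he hval using fun q =>
      ρ.exists_isDense_orthogonal_iff_valid adj (x q) (φ q) (ψ q)
    refine ⟨𝕋', Γ, Δ, e, hΓ, he, funext fun M => propext ?_⟩
    have hval' : ∀ q : 𝕋', Function.Bijective (fun g : Δ q ⟶ M => e q ≫ g) ↔ q.1.Valid M.obj :=
      fun q => by rw [hval q M, ← hq q]
    rw [hE, MorphismProperty.isLocal_iff]
    constructor
    · rintro hM _ _ _ ⟨q⟩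
      exact (hval' q).mpr (hM q.1 (Or.inr q.2))
    · rintro hM q (hq | hq)
      · exact M.property q hq
      · exact (hval' ⟨q, hq⟩).mp (hM _ (MorphismProperty.ofHoms.mk (⟨q, hq⟩ : 𝕋')))
  tfae_have 2 → 3 := by
    rintro ⟨I, Γ, Δ, e, hΓ, he, rfl⟩
    have hloc : ∀ M, (MorphismProperty.ofHoms e).isLocal M ↔
        ∀ i, Function.Bijective (fun g : Δ i ⟶ M => e i ≫ g) := fun M => by
      constructor
      · exact fun hM i => hM _ ⟨i⟩
      · rintro hM _ _ _ ⟨i⟩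
        exact hM i
    refine ⟨fun J => inferInstance, fun M N m hm hN => ?_, fun M N p hp hM => ?_,
      fun J _ _ => ⟨fun M ⟨P⟩ => ?_⟩⟩
    · rw [hloc] at hN ⊢
      refine fun i => (he i).bijective_of_exists fun g => ?_
      obtain ⟨k, hk⟩ := (hN i).2 (g ≫ m)
      exact (he i).exists_lift hm g k hk.symm
    · rw [hloc] at hM ⊢
      exact fun i => (he i).bijective_of_isSplitEpi adj p (hM i)
    · rw [hloc]
      intro i
      have := hΓ i
      exact (he i).bijective_of_isColimit adj P.isColimit fun j =>
        (hloc _).mp (P.prop_diag_obj j) i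
  tfae_have 3 → 1 := by
    rintro ⟨hprod, hsub, hretract, hcolim⟩
    refine ⟨{q | ρ.IsRelativeJudgment q ∧ ∀ A : PHL.PMod 𝕋, E A → q.Valid A.obj},
      fun q hq => hq.1, fun M => ⟨fun hM q hq => ?_, fun hM => ?_⟩⟩
    · rcases hq with hq | hq
      · exact M.property q hq
      · exact hq.2 M hM
    · exact ρ.prop_of_valid E hprod hsub hretract hcolim M fun q hq hval =>
        hM q (Or.inr ⟨hq, hval⟩)
  tfae_finish
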